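/- Conventions. Let $\mathbb F$ be a field. A symplectic alternating algebra (SAA) over $\mathbb F$ is an $\mathbb F$-vector space $L$ with a non-degenerate alternating form $(\cdot,\cdot)$ and a bilinear alternating product such that $(xy,z)=(yz,x)$ for all $x,y,z\in L$; isomorphisms of SAAs are the linear bijections that preserve the product and the form. Put $L^1=L$, $L^{k+1}=L^kL$, $Z_0(L)=0$, $Z_{k+1}(L)=\{x\in L: xL\le Z_k(L)\}$ and $Z(L)=Z_1(L)$; $L$ is nilpotent if $L^k=0$ for some $k$. A standard basis of an SAA of dimension $10$ is a basis $x_1,y_1,\dots,x_5,y_5$ with $(x_i,x_j)=(y_i,y_j)=0$ and $(x_i,y_j)=\delta_{ij}$. A nilpotent presentation lists values of $(x_iy_j,y_k)$ and $(y_iy_j,y_k)$ with $i<j<k$; all triple values of basis elements that are not listed (up to reordering) are $0$. It determines an SAA up to isomorphism, the algebra that it describes. For $r,s\in\mathbb F$ let $$\mathcal P_{10}^{(3,8)}(r,s):\ (x_2y_4,y_5)=r,\ (x_1y_3,y_5)=s,\ (x_1y_2,y_4)=1,\ (y_1y_2,y_5)=1,\ (y_1y_3,y_4)=1.$$ Proposition.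 Let $\mathbb F$ be a field of characteristic different from $2$. (1) Let $L$ be a nilpotent SAA over $\mathbb F$ of dimension $10$ whose centre $Z(L)$ is isotropic of dimension $3$, with $\dim L^3=6$ and $L^3L^2=L^5$. Choose $y_2\in L^2\setminus L^3$ and $y_3\in Z_4(L)\setminus L^2$, let $\phi,\psi:L^3/L^4\to L^5$ be the linear maps $u+L^4\mapsto uy_2$ and $u+L^4\mapsto uy_3$ ($\phi$ is bijective), and let $\tau=\psi\phi^{-1}:L^5\to L^5$. Suppose that $L$ is of type C, that is, the minimal polynomial of $\tau$ is irreducible in $\mathbb F[t]$ (this does not depend on the choice of $y_2$ and $y_3$). Then, with respect to some standard basis, $L$ has the presentation $\mathcal P_{10}^{(3,8)}(r,s)$ for some $r,s\in\mathbb F$ with $r\neq0$ and $s\notin\mathbb F^2=\{a^2:a\in\mathbb F\}$. (2) Let $r,\tilde r\in\mathbb F\setminus\{0\}$ and $s,\tilde s\in\mathbb F\setminus\mathbb F^2$. The presentations $\mathcal P_{10}^{(3,8)}(\tilde r,\tilde s)$ and $\mathcal P_{10}^{(3,8)}(r,s)$ describe the same algebra up to isomorphism if and only if $\tilde r/r\in(\mathbb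 F^*)^3$ and $s/\tilde s\in G(s)$, where $G(s)=\{(x^2-y^2s)^2:(x,y)\in\mathbb F\times\mathbb F\setminus\{(0,0)\}\}$. -/

import Mathlib

/-- A symplectic alternating algebra structure on a vector space `L`: a non-degenerate alternating
form and an alternating product with `(x·y, z) = (y·z, x)`. -/
structure SympAltAlg (F : Type*) [Field F] (L : Type*) [AddCommGroup L] [Module F L] where
  form : L →ₗ[F] L →ₗ[F] F
  mul : L →ₗ[F] L →ₗ[F] L
  form_self : ∀ x, form x x = 0
  form_nondegenerate : ∀ x, (∀ y, form x y = 0) → x = 0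
  mul_self : ∀ x, mul x x = 0
  form_mul : ∀ x y z, form (mul x y) z = form (mul y z) x

namespace SympAltAlg

section General

variable {F : Type*} [Field F] {L : Type*} [AddCommGroup L] [Module F L]
  {M : Type*} [AddCommGroup M] [Module F M]

/-- An isomorphism of symplectic alternating algebras: a linear bijection that preserves both the
product and the form. -/
structure Iso (A : SympAltAlg F L) (B : SympAltAlg F M) extends L ≃ₗ[F] M where
  map_mul : ∀ x y, toLinearEquiv (A.mul x y) = B.mul (toLinearEquiv x) (toLinearEquiv y)
  map_form : ∀ x y, B.form (toLinearEquiv x) (toLinearEquiv y) = A.form x y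

/-- The product `U·V` of two subspaces: the span of all `u·v`. -/
def prod (A : SympAltAlg F L) (U V : Submodule F L) : Submodule F L :=
  Submodule.map₂ A.mul U V

/-- The lower central series with the usual indexing `L^1 = L`, `L^(k+1) = L^k·L`
(and, as a convention, `L^0 = L`). -/
def pow (A : SympAltAlg F L) : ℕ → Submodule F L
  | 0 => ⊤
  | 1 => ⊤
  | k + 2 => A.prod (A.pow (k + 1)) ⊤

/-- The upper central series: `Z_0 = 0`, `Z_(k+1) = {x | x·L ≤ Z_k}`. -/
def upper (A : SympAltAlg F L) : ℕ → Submodule F L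
  | 0 => ⊥
  | k + 1 =>
    { carrier := {x | ∀ y, A.mul x y ∈ A.upper k}
      add_mem' := fun hx hy z => by
        simpa using (A.upper k).add_mem (hx z) (hy z)
      zero_mem' := fun z => by simp
      smul_mem' := fun c x hx z => by
        simpa using (A.upper k).smul_mem c (hx z) }

/-- The centre `Z(L) = {x | x·L = 0}`. -/
def center (A : SympAltAlg F L) : Submodule F L := A.upper 1

def IsNilpotent (A : SympAltAlg F L) : Prop := ∃ k, A.pow k = ⊥

/-- A subspace is isotropic if the form vanishes on it. -/
def IsIsotropic (A : SympAltAlg F L) (U : Submodule F L) : Prop :=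
  ∀ u ∈ U, ∀ v ∈ U, A.form u v = 0

/-- A standard basis `x_1, y_1, …, x_n, y_n`, where `x_(i+1) = b (inl i)`, `y_(i+1) = b (inr i)`. -/
structure IsStandardBasis {n : ℕ} (A : SympAltAlg F L)
    (b : Module.Basis (Fin n ⊕ Fin n) F L) : Prop where
  form_xx : ∀ i j, A.form (b (Sum.inl i)) (b (Sum.inl j)) = 0
  form_yy : ∀ i j, A.form (b (Sum.inr i)) (b (Sum.inr j)) = 0
  form_xy : ∀ i j, A.form (b (Sum.inl i)) (b (Sum.inr j)) = if i = j then 1 else 0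

end General

/-- The data `(x_i y_j, y_k) = xyy i j k` and `(y_i y_j, y_k) = yyy i j k` of a nilpotent
presentation. Only the values with `i < j < k` matter. -/
structure NilpPres (F : Type*) (n : ℕ) where
  xyy : Fin n → Fin n → Fin n → F
  yyy : Fin n → Fin n → Fin n → F

/-- `A` has the nilpotent presentation `P` with respect to the standard basis `b`: the listed
triples have the listed values, and all triples of basis elements that are not listed (up to
reordering) have the value `0`. -/
structure IsPresentedBy {F : Type*} [Field F] {L : Type*} [AddCommGroup L] [Module F L] {n : ℕ}
    (A : SympAltAlg F L) (b : Module.Basis (Fin n ⊕ Fin n) F L) (P : NilpPres F n) : Prop where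
  standard : A.IsStandardBasis b
  xyy : ∀ i j k, i < j → j < k →
    A.form (A.mul (b (Sum.inl i)) (b (Sum.inr j))) (b (Sum.inr k)) = P.xyy i j k
  yyy : ∀ i j k, i < j → j < k →
    A.form (A.mul (b (Sum.inr i)) (b (Sum.inr j))) (b (Sum.inr k)) = P.yyy i j k
  xyy_zero : ∀ i j k, j ≤ i → j < k →
    A.form (A.mul (b (Sum.inl i)) (b (Sum.inr j))) (b (Sum.inr k)) = 0
  xxy_zero : ∀ i j k, A.form (A.mul (b (Sum.inl i)) (b (Sum.inl j))) (b (Sum.inr k)) = 0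
  xxx_zero : ∀ i j k, A.form (A.mul (b (Sum.inl i)) (b (Sum.inl j))) (b (Sum.inl k)) = 0

/-- `A` has the presentation `P` with respect to some standard basis. -/
def HasPresentation {F : Type*} [Field F] {L : Type*} [AddCommGroup L] [Module F L] {n : ℕ}
    (A : SympAltAlg F L) (P : NilpPres F n) : Prop :=
  ∃ b : Module.Basis (Fin n ⊕ Fin n) F L, A.IsPresentedBy b P

namespace NilpPres

variable {F : Type*} [Field F] {n : ℕ}

/-- The alternating trilinear form on `F^ι` which is `1` on the unit vectors `e_p, e_q, e_t`
(`p, q, t` distinct) and `0` on triples of unit vectors that are not a reordering of these. -/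
def minor {ι : Type*} (p q t : ι) (u v w : ι → F) : F :=
  Matrix.det !![u p, u q, u t; v p, v q, v t; w p, w q, w t]

/-- The trilinear form `(u·v, w)` of the algebra with presentation `P`, in coordinates. -/
def triple (P : NilpPres F n) (u v w : Fin n ⊕ Fin n → F) : F :=
  ∑ i, ∑ j, ∑ k, if i < j ∧ j < k then
    P.xyy i j k * minor (Sum.inl i) (Sum.inr j) (Sum.inr k) u v w
      + P.yyy i j k * minor (Sum.inr i) (Sum.inr j) (Sum.inr k) u v w
  else 0

theorem triple_add_left (P : NilpPres F n) (u u' v w : Fin n ⊕ Fin n → F) :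
    P.triple (u + u') v w = P.triple u v w + P.triple u' v w := by
  simp only [triple, ← Finset.sum_add_distrib]
  refine Finset.sum_congr rfl fun i _ => Finset.sum_congr rfl fun j _ =>
    Finset.sum_congr rfl fun k _ => ?_
  split_ifs
  · simp [minor, Matrix.det_fin_three]; ring
  · simp

theorem triple_smul_left (P : NilpPres F n) (c : F) (u v w : Fin n ⊕ Fin n → F) :
    P.triple (c • u) v w = c * P.triple u v w := by
  simp only [triple, Finset.mul_sum]
  refine Finset.sum_congr rfl fun i _ => Finset.sum_congr rfl fun j _ =>
    Finset.sum_congr rfl fun k _ => ?_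
  split_ifs
  · simp [minor, Matrix.det_fin_three]; ring
  · simp

theorem triple_self (P : NilpPres F n) (u w : Fin n ⊕ Fin n → F) : P.triple u u w = 0 := by
  simp only [triple]
  refine Finset.sum_eq_zero fun i _ => Finset.sum_eq_zero fun j _ =>
    Finset.sum_eq_zero fun k _ => ?_
  split_ifs
  · simp [minor, Matrix.det_fin_three]; ring
  · simp

theorem triple_rotate (P : NilpPres F n) (u v w : Fin n ⊕ Fin n → F) :
    P.triple u v w = P.triple v w u := by
  simp only [triple]
  refine Finset.sum_congr rfl fun i _ => Finset.sum_congr rfl fun j _ =>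
    Finset.sum_congr rfl fun k _ => ?_
  split_ifs
  · simp [minor, Matrix.det_fin_three]; ring
  · simp

/-- The standard symplectic form in the coordinates of a standard basis. -/
def stdForm (F : Type*) [Field F] (n : ℕ) :
    (Fin n ⊕ Fin n → F) →ₗ[F] (Fin n ⊕ Fin n → F) →ₗ[F] F :=
  LinearMap.mk₂ F
    (fun u v => ∑ i, (u (Sum.inl i) * v (Sum.inr i) - u (Sum.inr i) * v (Sum.inl i)))
    (fun u u' v => by
      rw [← Finset.sum_add_distrib]; refine Finset.sum_congr rfl fun i _ => ?_; simp; ring)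
    (fun c u v => by
      rw [smul_eq_mul, Finset.mul_sum]; refine Finset.sum_congr rfl fun i _ => ?_; simp; ring)
    (fun u v v' => by
      rw [← Finset.sum_add_distrib]; refine Finset.sum_congr rfl fun i _ => ?_; simp; ring)
    (fun c u v => by
      rw [smul_eq_mul, Finset.mul_sum]; refine Finset.sum_congr rfl fun i _ => ?_; simp; ring)

/-- The product determined by `(u·v, w) = P.triple u v w`: the `x_i`-coordinate of `u·v` is
`(u·v, y_i)` and its `y_i`-coordinate is `-(u·v, x_i)`. -/
def stdMul (P : NilpPres F n) :
    (Fin n ⊕ Fin n → F) →ₗ[F] (Fin n ⊕ Fin n → F) →ₗ[F] (Fin n ⊕ Fin n → F) :=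
  LinearMap.mk₂ F
    (fun u v => Sum.elim (fun i => P.triple u v (Pi.single (Sum.inr i) 1))
      (fun i => - P.triple u v (Pi.single (Sum.inl i) 1)))
    (fun u u' v => by
      ext (i | i) <;> simp [triple_add_left]; ring)
    (fun c u v => by
      ext (i | i) <;> simp [triple_smul_left])
    (fun u v v' => by
      ext (i | i) <;> simp only [Pi.add_apply, Sum.elim_inl, Sum.elim_inr] <;>
        rw [P.triple_rotate u, P.triple_rotate u, P.triple_rotate u, triple_add_left]
      ring)
    (fun c u v => by
      ext (i | i) <;> simp only [Pi.smul_apply, Sum.elim_inl, Sum.elim_inr, smul_eq_mul] <;>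
        rw [P.triple_rotate u, P.triple_rotate u, triple_smul_left]
      ring)

theorem stdForm_stdMul (P : NilpPres F n) (u v w : Fin n ⊕ Fin n → F) :
    stdForm F n (P.stdMul u v) w = P.triple u v w := by
  let T : (Fin n ⊕ Fin n → F) →ₗ[F] F :=
    { toFun := fun w => P.triple u v w
      map_add' := fun w w' => by
        rw [← triple_rotate P (w + w'), ← triple_rotate P w, ← triple_rotate P w', triple_add_left]
      map_smul' := fun c w => by
        rw [← triple_rotate P (c • w), ← triple_rotate P w, triple_smul_left]; rfl }
  change _ = T w
  rw [LinearMap.pi_apply_eq_sum_univ T w, Fintype.sum_sum_type, ← Finset.sum_add_distrib]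
  simp only [stdForm, stdMul, LinearMap.mk₂_apply, Sum.elim_inl, Sum.elim_inr]
  refine Finset.sum_congr rfl fun i _ => ?_
  have h : ∀ a : Fin n ⊕ Fin n, (fun j => if a = j then (1 : F) else 0) = Pi.single a 1 := by
    intro a; ext j; simp [Pi.single_apply, eq_comm]
  simp only [h, smul_eq_mul]
  change _ = w (Sum.inl i) * P.triple u v (Pi.single (Sum.inl i) 1)
    + w (Sum.inr i) * P.triple u v (Pi.single (Sum.inr i) 1)
  ring

/-- The symplectic alternating algebra (of dimension `2n`) that the presentation `P` describes:
the unit vectors of `F^(2n)` are the standard basis. -/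
def algebra (P : NilpPres F n) : SympAltAlg F (Fin n ⊕ Fin n → F) where
  form := stdForm F n
  mul := P.stdMul
  form_self u := by
    simp only [stdForm, LinearMap.mk₂_apply]
    exact Finset.sum_eq_zero fun i _ => by ring
  form_nondegenerate u h := by
    ext (i | i)
    · simpa [stdForm, Pi.single_apply] using h (Pi.single (Sum.inr i) 1)
    · simpa [stdForm, Pi.single_apply] using h (Pi.single (Sum.inl i) 1)
  mul_self u := by
    ext (i | i) <;> simp [stdMul, triple_self]
  form_mul u v w := by
    rw [stdForm_stdMul, stdForm_stdMul, triple_rotate]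

/-- Two presentations describe the same algebra: the algebras they determine are isomorphic. -/
def DescribeSame (P Q : NilpPres F n) : Prop := Nonempty (Iso P.algebra Q.algebra)

/-- `P_10^(3,8)(r,s)`: `(x₂y₄,y₅) = r`, `(x₁y₃,y₅) = s`, `(x₁y₂,y₄) = 1`, `(y₁y₂,y₅) = 1`,
`(y₁y₃,y₄) = 1`. The indices of the code start at `0`. -/
def P38 (r s : F) : NilpPres F 5 where
  xyy i j k :=
    if i = 1 ∧ j = 3 ∧ k = 4 then r
    else if i = 0 ∧ j = 2 ∧ k = 4 then s
    else if i = 0 ∧ j = 1 ∧ k = 3 then 1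
    else 0
  yyy i j k :=
    if i = 0 ∧ j = 1 ∧ k = 4 then 1
    else if i = 0 ∧ j = 2 ∧ k = 3 then 1
    else 0

end NilpPres

section TypeC

variable {F : Type*} [Field F] {L : Type*} [AddCommGroup L] [Module F L]

/-- `τ : L^5 → L^5` is the map `ψ φ⁻¹` belonging to the elements `y₂`, `y₃`, where
`φ, ψ : L^3 / L^4 → L^5` are the linear maps induced by `u ↦ u·y₂` (bijective) and `u ↦ u·y₃`. -/
def IsTau (A : SympAltAlg F L) (y₂ y₃ : L) (τ : Module.End F (A.pow 5)) : Prop :=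
  ∃ (φ : (A.pow 3 ⧸ (A.pow 4).submoduleOf (A.pow 3)) ≃ₗ[F] A.pow 5)
    (ψ : (A.pow 3 ⧸ (A.pow 4).submoduleOf (A.pow 3)) →ₗ[F] A.pow 5),
    (∀ u : A.pow 3, (φ (Submodule.Quotient.mk u) : L) = A.mul u y₂) ∧
    (∀ u : A.pow 3, (ψ (Submodule.Quotient.mk u) : L) = A.mul u y₃) ∧
    τ = ψ ∘ₗ φ.symm.toLinearMap

/-- Type C: the minimal polynomial of `τ = ψ φ⁻¹` is irreducible over `F`. In a standard basis
adapted to the central series, `L^2 = L^3 + F y₂` and `Z_4(L) = L^2 + F y₃`; these two elements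
enter only through `y₂ ∈ L^2 \ L^3` and `y₃ ∈ Z_4(L) \ L^2`. Neither the existence of `τ` (it is
unique once `y₂`, `y₃` are given) nor the independence of the choice of `y₂`, `y₃` is built in. -/
def IsTypeC (A : SympAltAlg F L) : Prop :=
  ∃ y₂ ∈ A.pow 2, y₂ ∉ A.pow 3 ∧ ∃ y₃ ∈ A.upper 4, y₃ ∉ A.pow 2 ∧
    ∀ τ : Module.End F (A.pow 5), A.IsTau y₂ y₃ τ → Irreducible (minpoly F τ)

end TypeC

/-- `G(s) = {(x² - y² s)² : (x, y) ≠ (0, 0)}`. -/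
def G {F : Type*} [Field F] (s : F) : Set F :=
  {g | ∃ x y : F, (x, y) ≠ (0, 0) ∧ g = (x ^ 2 - y ^ 2 * s) ^ 2}

end SympAltAlg

/-
Invariance of the triple form gives `Z_k = (L^{k+1})^⊥` and `Z_k L^k = 0`. In the family at hand
this forces `L^3 = Z_3`, `L^4 = Z_2` and `dim L^5 = 2`, so that `L^3 < L^2 < Z_4` is a canonical
flag and `L^3/L^4` acts on `Z_4/L^3 = ⟨y₂, y₃⟩` with values in `L^5`. In characteristic `≠ 2` one
can replace `y₃` by some `y₃ - t y₂` to make `τ` trace-free; for type C this means `τ² = s` with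
`s` a nonsquare. Hence there are `x₁, y₁ ∈ L^3` with `y₁y₃ = x₁y₂` and `x₁y₃ = s y₁y₂`, and
duality completes `x₁, y₁, y₂, y₃` to a standard basis in which only the factor `r` of
`y₅y₄ = r y₂` remains to be chosen.

An isomorphism respects the flag. Modulo lower terms it sends `x₁, y₁` to `a x₁ + b y₁` and
`c x₁ + d y₁`, and `y₂` to `m y₂`. Comparing `x₁y₃` and `y₁y₃` turns `s` into
`s' = s / (d² - c² s)²`, and comparing `y₅y₄` modulo `L^3` turns `r` into `r / m³`. Conversely,
every such change is realised by mixing `x₁` with `y₁` and rescaling `y₂`.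
-/

namespace SympAltAlg

open Module Submodule

section LinearAlgebra

variable {F : Type*} [Field F] {V W : Type*} [AddCommGroup V] [Module F V]
  [AddCommGroup W] [Module F W]

theorem exists_mem_notMem_of_finrank_lt [FiniteDimensional F V] {U U' : Submodule F V}
    (h : finrank F U < finrank F U') : ∃ x ∈ U', x ∉ U :=
  SetLike.not_le_iff_exists.1 fun hle => (finrank_mono hle).not_gt h

theorem sup_span_singleton_eq [FiniteDimensional F V] {U U' : Submodule F V} {v : V} (hU : U ≤ U')
    (hv : v ∈ U') (hv' : v ∉ U) (h : finrank F U' ≤ finrank F U + 1) : U ⊔ F ∙ v = U' := by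
  have hlt : U < U ⊔ F ∙ v := left_lt_sup.2 fun hle => hv' (hle (mem_span_singleton_self v))
  refine eq_of_le_of_finrank_le (sup_le hU ((span_singleton_le_iff_mem _ _).2 hv)) ?_
  have := finrank_lt_finrank_of_lt hlt
  omega

theorem exists_add_smul_eq_of_mem_sup {U : Submodule F V} {v w : V} (h : w ∈ U ⊔ F ∙ v) :
    ∃ u ∈ U, ∃ c : F, u + c • v = w := by
  obtain ⟨u, hu, v', hv', rfl⟩ := mem_sup.1 h
  obtain ⟨c, rfl⟩ := mem_span_singleton.1 hv'
  exact ⟨u, hu, c, rfl⟩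

theorem apply_eq_zero_of_mem_sup_span_singleton {B : V →ₗ[F] V →ₗ[F] W} (hB : B.IsAlt)
    {U : Submodule F V} {x : V} (hU : ∀ u ∈ U, ∀ v ∈ U, B u v = 0) (hx : ∀ u ∈ U, B u x = 0)
    {v w : V} (hv : v ∈ U ⊔ F ∙ x) (hw : w ∈ U ⊔ F ∙ x) : B v w = 0 := by
  obtain ⟨u, hu, c, rfl⟩ := exists_add_smul_eq_of_mem_sup hv
  obtain ⟨u', hu', c', rfl⟩ := exists_add_smul_eq_of_mem_sup hw
  have hxu' : B x u' = 0 := hB.isRefl _ _ (hx u' hu')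
  simp [hU u hu u' hu', hx u hu, hxu', hB.self_eq_zero]

open Polynomial in
theorem exists_eq_sub_sq_sub_of_natDegree_eq_two (h2 : (2 : F) ≠ 0) {p : F[X]} (hp : p.Monic)
    (hdeg : p.natDegree = 2) : ∃ t s : F, p = (X - C t) ^ 2 - C s := by
  have hlead : p.coeff 2 = 1 := hdeg ▸ hp.coeff_natDegree
  obtain ⟨t, ht⟩ : ∃ t, p.coeff 1 = -(2 * t) := ⟨-p.coeff 1 / 2, by field_simp⟩
  refine ⟨t, t ^ 2 - p.coeff 0, ?_⟩
  conv_lhs => rw [p.as_sum_range_C_mul_X_pow, hdeg]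
  simp only [Finset.sum_range_succ, Finset.sum_range_zero, hlead, ht, map_neg, map_mul, map_sub,
    map_pow, map_ofNat, map_one]
  ring

open Polynomial in
theorem exists_sub_sq_eq_of_irreducible_minpoly (h2 : (2 : F) ≠ 0) (hV : finrank F V = 2)
    {τ : End F V} (hirr : Irreducible (minpoly F τ)) (hτ : ∀ c : F, τ ≠ algebraMap F _ c) :
    ∃ t s : F, ¬ IsSquare s ∧ (τ - algebraMap F _ t) ^ 2 = algebraMap F _ s := by
  have : FiniteDimensional F V := finite_of_finrank_eq_succ hV
  obtain ⟨t, s, hp⟩ := exists_eq_sub_sq_sub_of_natDegree_eq_two h2 τ.charpoly_monic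
    (τ.charpoly_natDegree.trans hV)
  refine ⟨t, s, ?_, ?_⟩
  · rintro ⟨a, rfl⟩
    have not_dvd (e : F) : ¬ minpoly F τ ∣ X - C e := fun h => hτ e <| by
      simpa [sub_eq_zero] using aeval_eq_zero_of_dvd_aeval_eq_zero h (minpoly.aeval F τ)
    have hfactor : τ.charpoly = (X - C (t + a)) * (X - C (t - a)) := by
      rw [hp, map_add, map_sub, map_mul]; ring
    exact (hirr.prime.dvd_or_dvd (hfactor ▸ τ.minpoly_dvd_charpoly)).elim (not_dvd _) (not_dvd _)
  · simpa [hp, sub_eq_zero] using τ.aeval_self_charpoly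

theorem linearIndependent_pair_apply_of_sq_eq {T : End F V} {s : F} (hs : ¬ IsSquare s)
    (hT : T ^ 2 = algebraMap F _ s) {v : V} (hv : v ≠ 0) : LinearIndependent F ![v, T v] := by
  refine (LinearIndependent.pair_iff' hv).2 fun a ha => hs ⟨a, ?_⟩
  have h : T (T v) = s • v := by simpa [sq] using DFunLike.congr_fun hT v
  rw [← ha, map_smul, ← ha, smul_smul] at h
  exact (smul_left_injective F hv h).symm

theorem card_le_finrank_of_linearIndependent [FiniteDimensional F V] {ι : Type*} [Fintype ι]
    {U : Submodule F V} {v : ι → V} (hv : LinearIndependent F v) (hU : ∀ i, v i ∈ U) :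
    Fintype.card ι ≤ finrank F U := by
  rw [← finrank_span_eq_card hv]
  exact finrank_mono (span_le.2 (Set.range_subset_iff.2 hU))

end LinearAlgebra

section Basics

variable {F : Type*} [Field F] {L : Type*} [AddCommGroup L] [Module F L] (A : SympAltAlg F L)

theorem isAlt_form : A.form.IsAlt := A.form_self

theorem isAlt_mul : A.mul.IsAlt := A.mul_self

theorem form_skew (x y : L) : A.form x y = -A.form y x := (A.isAlt_form.neg y x).symm

theorem mul_skew (x y : L) : A.mul x y = -A.mul y x := (A.isAlt_mul.neg y x).symm

theorem form_mul_comm (x y z : L) : A.form (A.mul x y) z = A.form x (A.mul z y) := by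
  rw [A.form_mul, A.form_skew, A.mul_skew, map_neg, neg_neg]

theorem form_mul_self_right (x y : L) : A.form (A.mul x y) y = 0 := by
  rw [form_mul_comm, A.mul_self, map_zero]

theorem form_mul_swap (x y z : L) : A.form (A.mul x y) z = -A.form (A.mul y x) z := by
  rw [A.mul_skew x y, map_neg, LinearMap.neg_apply]

theorem eq_of_form_eq {x y : L} (h : ∀ z, A.form x z = A.form y z) : x = y :=
  sub_eq_zero.1 <| A.form_nondegenerate _ fun z => by
    rw [map_sub, LinearMap.sub_apply, h, sub_self]

theorem nondegenerate_form : LinearMap.BilinForm.Nondegenerate A.form :=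
  ⟨A.form_nondegenerate, fun y h => A.form_nondegenerate y fun x => A.isAlt_form.isRefl _ _ (h x)⟩

/-- The orthogonal complement of a subspace with respect to the symplectic form. -/
def perp (U : Submodule F L) : Submodule F L := LinearMap.BilinForm.orthogonal A.form U

variable {A} in
theorem mem_perp {U : Submodule F L} {x : L} : x ∈ A.perp U ↔ ∀ u ∈ U, A.form u x = 0 := Iff.rfl

theorem perp_anti {U V : Submodule F L} (h : U ≤ V) : A.perp V ≤ A.perp U :=
  LinearMap.BilinForm.orthogonal_le h

theorem finrank_perp [FiniteDimensional F L] (U : Submodule F L) :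
    finrank F (A.perp U) + finrank F U = finrank F L := by
  rw [perp, LinearMap.BilinForm.finrank_orthogonal A.nondegenerate_form,
    Nat.sub_add_cancel (Submodule.finrank_le U)]

theorem perp_perp [FiniteDimensional F L] (U : Submodule F L) : A.perp (A.perp U) = U :=
  LinearMap.BilinForm.orthogonal_orthogonal A.nondegenerate_form A.isAlt_form.isRefl U

theorem mem_perp_prod {U V : Submodule F L} {x : L} :
    x ∈ A.perp (A.prod U V) ↔ ∀ u ∈ U, ∀ v ∈ V, A.form (A.mul u v) x = 0 := by
  rw [mem_perp]
  refine ⟨fun h u hu v hv => h _ (apply_mem_map₂ _ hu hv), fun h => ?_⟩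
  have hle : A.prod U V ≤ LinearMap.ker (A.form.flip x) := map₂_le.2 h
  exact fun u hu => hle hu

theorem mul_mem_prod {U V : Submodule F L} {u v : L} (hu : u ∈ U) (hv : v ∈ V) :
    A.mul u v ∈ A.prod U V := apply_mem_map₂ _ hu hv

theorem prod_le {U V W : Submodule F L} (h : ∀ u ∈ U, ∀ v ∈ V, A.mul u v ∈ W) :
    A.prod U V ≤ W := map₂_le.2 h

theorem mul_mem_pow_succ {k : ℕ} {u : L} (hu : u ∈ A.pow (k + 1)) (v : L) :
    A.mul u v ∈ A.pow (k + 2) := A.mul_mem_prod hu mem_top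

theorem pow_succ_le (k : ℕ) : A.pow (k + 1) ≤ A.pow k := by
  induction k with
  | zero => exact le_rfl
  | succ k ih =>
    cases k with
    | zero => exact le_top
    | succ k => exact A.prod_le fun u hu v _ => A.mul_mem_pow_succ (ih hu) v

theorem pow_anti : Antitone A.pow := antitone_nat_of_succ_le A.pow_succ_le

theorem upper_eq_perp (k : ℕ) : A.upper k = A.perp (A.pow (k + 1)) := by
  induction k with
  | zero =>
    refine (eq_bot_iff.2 fun x hx => ?_).symm
    exact A.form_nondegenerate x fun y => A.isAlt_form.isRefl _ _ (mem_perp.1 hx y mem_top)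
  | succ k ih =>
    ext x
    calc x ∈ A.upper (k + 1) ↔ ∀ v, ∀ u ∈ A.pow (k + 1), A.form u (A.mul x v) = 0 := by
          simp only [← mem_perp, ← ih]; rfl
      _ ↔ ∀ u ∈ A.pow (k + 1), ∀ v ∈ (⊤ : Submodule F L), A.form (A.mul u v) x = 0 := by
          simp only [form_mul_comm, mem_top, true_imp_iff]; tauto
      _ ↔ x ∈ A.perp (A.pow (k + 2)) := A.mem_perp_prod.symm

theorem mem_upper_succ_iff {k : ℕ} {x : L} :
    x ∈ A.upper (k + 1) ↔ ∀ u ∈ A.pow (k + 1), A.mul x u = 0 := by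
  rw [upper_eq_perp, pow, mem_perp_prod]
  refine forall₂_congr fun u _ => ⟨fun h => A.form_nondegenerate _ fun v => ?_, fun h v _ => ?_⟩
  · rw [A.form_mul, h v mem_top]
  · rw [← A.form_mul, h, map_zero, LinearMap.zero_apply]

theorem mul_upper_pow {k : ℕ} {z u : L} (hz : z ∈ A.upper (k + 1)) (hu : u ∈ A.pow (k + 1)) :
    A.mul z u = 0 := A.mem_upper_succ_iff.1 hz u hu

theorem form_upper_pow {k : ℕ} {z u : L} (hz : z ∈ A.upper k) (hu : u ∈ A.pow (k + 1)) :
    A.form z u = 0 := by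
  rw [upper_eq_perp] at hz
  exact A.isAlt_form.isRefl _ _ (hz u hu)

theorem upper_mono : Monotone A.upper := monotone_nat_of_le_succ fun k => by
  rw [upper_eq_perp, upper_eq_perp]
  exact A.perp_anti (A.pow_succ_le _)

theorem perp_upper [FiniteDimensional F L] (k : ℕ) : A.perp (A.upper k) = A.pow (k + 1) := by
  rw [upper_eq_perp, perp_perp]

theorem finrank_upper_add_finrank_pow [FiniteDimensional F L] (k : ℕ) :
    finrank F (A.upper k) + finrank F (A.pow (k + 1)) = finrank F L := by
  rw [upper_eq_perp, finrank_perp]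

variable {A} in
theorem IsNilpotent.pow_le_upper_of_le_sup (hA : A.IsNilpotent) {k j : ℕ}
    (h : A.pow (k + 1) ≤ A.pow (k + 2) ⊔ A.upper j) : A.pow (k + 1) ≤ A.upper j := by
  have step (m : ℕ) : A.pow (k + m + 1) ≤ A.pow (k + m + 2) ⊔ A.upper j := by
    induction m with
    | zero => exact h
    | succ m ih =>
      refine A.prod_le fun u hu v _ => ?_
      obtain ⟨u', hu', z, hz, rfl⟩ := mem_sup.1 (ih hu)
      rw [map_add, LinearMap.add_apply]
      exact add_mem_sup (A.mul_mem_pow_succ hu' v) (A.upper_mono (Nat.le_succ j) hz v)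
  have descend (m : ℕ) : A.pow (k + 1) ≤ A.pow (k + m + 1) ⊔ A.upper j := by
    induction m with
    | zero => exact le_sup_left
    | succ m ih => exact ih.trans (sup_le (step m) le_sup_right)
  obtain ⟨c, hc⟩ := hA
  have hzero : A.pow (k + c + 1) = ⊥ := le_bot_iff.1 ((A.pow_anti (by omega)).trans hc.le)
  simpa [hzero] using descend c

theorem exists_linearIndependent_mul {x : L} (hx : x ∉ A.upper 1) :
    ∃ y z, LinearIndependent F ![A.mul x y, A.mul x z] := by
  obtain ⟨y, hy⟩ : ∃ y, A.mul x y ≠ 0 := by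
    by_contra! h
    exact hx (A.mem_upper_succ_iff.2 fun y _ => h y)
  obtain ⟨z, hz⟩ : ∃ z, A.form (A.mul x y) z ≠ 0 := by
    by_contra! h
    exact hy (A.form_nondegenerate _ h)
  refine ⟨y, z, LinearIndependent.pair_iff.2 fun a b hab => ?_⟩
  have hzy : A.form (A.mul x z) y = -A.form (A.mul x y) z := by
    rw [A.form_mul, A.form_mul_swap, ← A.form_mul x y]
  have hb := congrArg (A.form · y) hab
  have ha := congrArg (A.form · z) hab
  exact ⟨by simpa [form_mul_self_right, hz] using ha,
    by simpa [form_mul_self_right, hzy, hz] using hb⟩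

end Basics

section Family

variable {F : Type*} [Field F] {L : Type*} [AddCommGroup L] [Module F L]

/-- The family of nilpotent algebras of dimension `10` that the proposition classifies: the centre
is isotropic of dimension `3`, `dim L^3 = 6` and `L^3·L^2 = L^5`. -/
structure IsFamily38 (A : SympAltAlg F L) : Prop where
  finrank_eq : finrank F L = 10
  isNilpotent : A.IsNilpotent
  isIsotropic_center : A.IsIsotropic (A.upper 1)
  finrank_center : finrank F (A.upper 1) = 3
  finrank_pow_three : finrank F (A.pow 3) = 6
  prod_pow_three_pow_two : A.prod (A.pow 3) (A.pow 2) = A.pow 5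

namespace IsFamily38

variable {A : SympAltAlg F L}

theorem finiteDimensional (hA : A.IsFamily38) : FiniteDimensional F L :=
  finite_of_finrank_eq_succ hA.finrank_eq

theorem finrank_pow_two (hA : A.IsFamily38) : finrank F (A.pow 2) = 7 := by
  have := hA.finiteDimensional
  have : finrank F (A.upper 1) + finrank F (A.pow 2) = finrank F L :=
    A.finrank_upper_add_finrank_pow 1
  have := hA.finrank_eq
  have := hA.finrank_center
  omega

theorem finrank_upper_two (hA : A.IsFamily38) : finrank F (A.upper 2) = 4 := by
  have := hA.finiteDimensional
  have : finrank F (A.upper 2) + finrank F (A.pow 3) = finrank F L :=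
    A.finrank_upper_add_finrank_pow 2
  have := hA.finrank_eq
  have := hA.finrank_pow_three
  omega

theorem pow_three_sup_span_eq (hA : A.IsFamily38) {y₂ : L} (h₂ : y₂ ∈ A.pow 2)
    (h₂' : y₂ ∉ A.pow 3) : A.pow 3 ⊔ F ∙ y₂ = A.pow 2 := by
  have := hA.finiteDimensional
  refine sup_span_singleton_eq (A.pow_succ_le 2) h₂ h₂' ?_
  rw [hA.finrank_pow_two, hA.finrank_pow_three]

theorem exists_mem_pow_two_notMem_pow_three (hA : A.IsFamily38) : ∃ y₂ ∈ A.pow 2, y₂ ∉ A.pow 3 := by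
  have := hA.finiteDimensional
  refine exists_mem_notMem_of_finrank_lt ?_
  rw [hA.finrank_pow_two, hA.finrank_pow_three]
  norm_num

theorem mem_pow_three_of_mem_upper (hA : A.IsFamily38) {j : ℕ} (hj : finrank F (A.upper j) < 7)
    {z : L} (hz : z ∈ A.upper j) (hz₂ : z ∈ A.pow 2) : z ∈ A.pow 3 := by
  have := hA.finiteDimensional
  by_contra hz₃
  have hle : A.pow 2 ≤ A.upper j := hA.isNilpotent.pow_le_upper_of_le_sup <| by
    rw [← hA.pow_three_sup_span_eq hz₂ hz₃]
    exact sup_le_sup_left ((span_singleton_le_iff_mem _ _).2 hz) _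
  have := finrank_mono hle
  have := hA.finrank_pow_two
  omega

theorem center_le_pow_three (hA : A.IsFamily38) : A.upper 1 ≤ A.pow 3 := by
  have := hA.finiteDimensional
  have hle : A.upper 1 ≤ A.pow 2 := by
    rw [← A.perp_upper 1]
    exact fun x hx u hu => hA.isIsotropic_center u hu x hx
  exact fun z hz => hA.mem_pow_three_of_mem_upper (by rw [hA.finrank_center]; norm_num) hz (hle hz)

theorem upper_two_le_pow_three (hA : A.IsFamily38) : A.upper 2 ≤ A.pow 3 := by
  have := hA.finiteDimensional
  have hle : A.upper 2 ≤ A.pow 2 := by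
    rw [A.upper_eq_perp 2, ← A.perp_upper 1]
    exact A.perp_anti hA.center_le_pow_three
  exact fun z hz =>
    hA.mem_pow_three_of_mem_upper (by rw [hA.finrank_upper_two]; norm_num) hz (hle hz)

theorem mul_pow_three_pow_three (hA : A.IsFamily38) {u v : L} (hu : u ∈ A.pow 3)
    (hv : v ∈ A.pow 3) : A.mul u v = 0 := by
  have := hA.finiteDimensional
  set W := A.perp (A.pow 4 ⊔ A.upper 2) with hW
  have hW₃ : W ≤ A.pow 3 := by
    rw [hW, ← A.perp_upper 2]
    exact A.perp_anti le_sup_right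
  have hW_mul : ∀ w ∈ W, ∀ u ∈ A.pow 3, A.mul w u = 0 := fun w hw u hu =>
    A.mul_upper_pow (A.upper_eq_perp 3 ▸ A.perp_anti le_sup_left hw) hu
  have hlt : A.pow 4 ⊔ A.upper 2 < A.pow 3 := by
    refine (sup_le (A.pow_succ_le 3) hA.upper_two_le_pow_three).lt_of_ne fun heq => ?_
    have := finrank_mono (hA.isNilpotent.pow_le_upper_of_le_sup heq.ge)
    rw [hA.finrank_pow_three, hA.finrank_upper_two] at this
    omega
  have hdim : finrank F (A.pow 3) ≤ finrank F W + 1 := by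
    have := finrank_lt_finrank_of_lt hlt
    have : finrank F W + finrank F ↥(A.pow 4 ⊔ A.upper 2) = finrank F L := A.finrank_perp _
    have := hA.finrank_eq
    rw [hA.finrank_pow_three] at *
    omega
  by_cases h : ∃ x ∈ A.pow 3, x ∉ W
  · obtain ⟨x, hx, hx'⟩ := h
    rw [← sup_span_singleton_eq hW₃ hx hx' hdim] at hu hv
    exact apply_eq_zero_of_mem_sup_span_singleton A.isAlt_mul
      (fun w hw w' hw' => hW_mul w hw w' (hW₃ hw')) (fun w hw => hW_mul w hw x hx) hu hv
  · push Not at h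
    exact hW_mul u (h u hu) v hv

theorem pow_three_le_upper_three (hA : A.IsFamily38) : A.pow 3 ≤ A.upper 3 := fun _ hu =>
  A.mem_upper_succ_iff.2 fun _ hv => hA.mul_pow_three_pow_three hu hv

theorem pow_two_le_upper_four (hA : A.IsFamily38) : A.pow 2 ≤ A.upper 4 := fun _ hu v =>
  hA.pow_three_le_upper_three (A.mul_mem_pow_succ hu v)

theorem pow_four_le_upper_two (hA : A.IsFamily38) : A.pow 4 ≤ A.upper 2 := by
  have := hA.finiteDimensional
  rw [← A.perp_upper 3, A.upper_eq_perp 2]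
  exact A.perp_anti hA.pow_three_le_upper_three

theorem pow_five_le_center (hA : A.IsFamily38) : A.pow 5 ≤ A.upper 1 :=
  A.prod_le fun _ hu v _ => hA.pow_four_le_upper_two hu v

theorem map_pow_three_eq (hA : A.IsFamily38) {y₂ : L} (h₂ : y₂ ∈ A.pow 2) (h₂' : y₂ ∉ A.pow 3) :
    (A.pow 3).map (A.mul.flip y₂) = A.pow 5 := by
  refine le_antisymm ?_ ?_
  · rintro _ ⟨u, hu, rfl⟩
    exact hA.prod_pow_three_pow_two ▸ A.mul_mem_prod hu h₂
  · rw [← hA.prod_pow_three_pow_two]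
    refine A.prod_le fun u hu v hv => ?_
    rw [← hA.pow_three_sup_span_eq h₂ h₂'] at hv
    obtain ⟨v, hv₃, c, rfl⟩ := exists_add_smul_eq_of_mem_sup hv
    exact ⟨c • u, smul_mem _ c hu, by simp [hA.mul_pow_three_pow_three hu hv₃]⟩

theorem mul_mem_pow_five (hA : A.IsFamily38) {u v : L} (hu : u ∈ A.pow 3) (hv : v ∈ A.pow 2) :
    A.mul u v ∈ A.pow 5 := hA.prod_pow_three_pow_two ▸ A.mul_mem_prod hu hv

theorem mem_upper_two_of_mul_eq_zero (hA : A.IsFamily38) {y₂ u : L} (h₂ : y₂ ∈ A.pow 2)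
    (h₂' : y₂ ∉ A.pow 3) (hu : ∀ v ∈ A.pow 3, A.mul u v = 0) (hu' : A.mul u y₂ = 0) :
    u ∈ A.upper 2 := by
  refine A.mem_upper_succ_iff.2 fun v (hv : v ∈ A.pow 2) => ?_
  rw [← hA.pow_three_sup_span_eq h₂ h₂'] at hv
  obtain ⟨v, hv₃, c, rfl⟩ := exists_add_smul_eq_of_mem_sup hv
  simp [hu v hv₃, hu']

theorem finrank_pow_five_le (hA : A.IsFamily38) : finrank F (A.pow 5) ≤ 2 := by
  have := hA.finiteDimensional
  obtain ⟨y₂, h₂, h₂'⟩ := hA.exists_mem_pow_two_notMem_pow_three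
  set f := (A.mul.flip y₂).domRestrict (A.pow 3)
  have hrange : LinearMap.range f = A.pow 5 := by
    rw [LinearMap.range_domRestrict, hA.map_pow_three_eq h₂ h₂']
  have hker : (A.upper 2).submoduleOf (A.pow 3) ≤ LinearMap.ker f := fun z hz =>
    A.mul_upper_pow (mem_comap.1 hz) h₂
  have hdim := f.finrank_range_add_finrank_ker
  rw [hrange, hA.finrank_pow_three] at hdim
  have := finrank_mono hker
  rw [(submoduleOfEquivOfLe hA.upper_two_le_pow_three).finrank_eq, hA.finrank_upper_two] at this
  omega

theorem two_le_finrank_pow_five (hA : A.IsFamily38) : 2 ≤ finrank F (A.pow 5) := by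
  have := hA.finiteDimensional
  obtain ⟨x, hx, hx'⟩ : ∃ x ∈ A.pow 4, x ∉ A.upper 1 := by
    by_contra! h
    have hle : A.pow 3 ≤ A.upper 2 := fun u hu v => h _ (A.mul_mem_pow_succ hu v)
    have := finrank_mono hle
    rw [hA.finrank_pow_three, hA.finrank_upper_two] at this
    omega
  obtain ⟨y, z, hyz⟩ := A.exists_linearIndependent_mul hx'
  have hmem (i : Fin 2) : ![A.mul x y, A.mul x z] i ∈ A.pow 5 := by
    fin_cases i <;> exact A.mul_mem_pow_succ hx _
  simpa using card_le_finrank_of_linearIndependent hyz hmem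

theorem finrank_pow_five (hA : A.IsFamily38) : finrank F (A.pow 5) = 2 :=
  hA.finrank_pow_five_le.antisymm hA.two_le_finrank_pow_five

theorem finrank_upper_four (hA : A.IsFamily38) : finrank F (A.upper 4) = 8 := by
  have := hA.finiteDimensional
  have := A.finrank_upper_add_finrank_pow 4
  rw [hA.finrank_eq, hA.finrank_pow_five] at this
  omega

theorem pow_two_sup_span_eq (hA : A.IsFamily38) {y₃ : L} (h₃ : y₃ ∈ A.upper 4)
    (h₃' : y₃ ∉ A.pow 2) : A.pow 2 ⊔ F ∙ y₃ = A.upper 4 := by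
  have := hA.finiteDimensional
  refine sup_span_singleton_eq hA.pow_two_le_upper_four h₃ h₃' ?_
  rw [hA.finrank_pow_two, hA.finrank_upper_four]

theorem finrank_upper_three_le (hA : A.IsFamily38) : finrank F (A.upper 3) ≤ 7 := by
  have := hA.finiteDimensional
  have hlt : A.pow 5 < A.pow 4 := by
    refine (A.pow_succ_le 4).lt_of_ne fun heq => ?_
    have hbot : A.pow 4 ≤ ⊥ :=
      hA.isNilpotent.pow_le_upper_of_le_sup (j := 0) (heq.ge.trans le_sup_left)
    have := hA.finrank_pow_five
    rw [heq, le_bot_iff.1 hbot, finrank_bot] at this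
    omega
  have := finrank_lt_finrank_of_lt hlt
  have : finrank F (A.upper 3) + finrank F (A.pow 4) = finrank F L :=
    A.finrank_upper_add_finrank_pow 3
  have := hA.finrank_eq
  have := hA.finrank_pow_five
  omega

theorem mul_upper_three_upper_three (hA : A.IsFamily38) {z w : L} (hz : z ∈ A.upper 3)
    (hw : w ∈ A.upper 3) : A.mul z w = 0 := by
  have := hA.finiteDimensional
  by_cases h : ∃ y ∈ A.upper 3, y ∉ A.pow 3
  · obtain ⟨y, hy, hy'⟩ := h
    have hZ₃ : A.pow 3 ⊔ F ∙ y = A.upper 3 := by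
      refine sup_span_singleton_eq hA.pow_three_le_upper_three hy hy' ?_
      rw [hA.finrank_pow_three]
      exact hA.finrank_upper_three_le
    rw [← hZ₃] at hz hw
    exact apply_eq_zero_of_mem_sup_span_singleton A.isAlt_mul
      (fun u hu v hv => hA.mul_pow_three_pow_three hu hv)
      (fun u hu => A.isAlt_mul.isRefl _ _ (A.mul_upper_pow hy hu)) hz hw
  · push Not at h
    exact hA.mul_pow_three_pow_three (h z hz) (h w hw)

theorem notMem_upper_three (hA : A.IsFamily38) {y₂ : L} (h₂ : y₂ ∈ A.pow 2) (h₂' : y₂ ∉ A.pow 3) :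
    y₂ ∉ A.upper 3 := fun h => by
  have hbot : A.pow 5 ≤ ⊥ := hA.map_pow_three_eq h₂ h₂' ▸ map_le_iff_le_comap.2 fun u hu =>
    hA.mul_upper_three_upper_three (hA.pow_three_le_upper_three hu) h
  have := hA.finrank_pow_five
  rw [le_bot_iff.1 hbot, finrank_bot] at this
  omega

theorem upper_three_eq (hA : A.IsFamily38) : A.upper 3 = A.pow 3 := by
  have := hA.finiteDimensional
  refine le_antisymm (fun y hy => ?_) hA.pow_three_le_upper_three
  by_contra hy'
  obtain ⟨y₂, h₂, h₂'⟩ := hA.exists_mem_pow_two_notMem_pow_three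
  have hZ₄ : A.upper 3 ⊔ F ∙ y₂ = A.upper 4 := by
    refine sup_span_singleton_eq (A.upper_mono (by norm_num)) (hA.pow_two_le_upper_four h₂)
      (hA.notMem_upper_three h₂ h₂') ?_
    have := finrank_lt_finrank_of_lt
      (hA.pow_three_le_upper_three.lt_of_not_ge fun hle => hy' (hle hy))
    rw [hA.finrank_pow_three] at this
    rw [hA.finrank_upper_four]
    omega
  have hyy₂ : A.mul y y₂ ∈ A.pow 5 := by
    rw [← A.perp_upper 4]
    intro z hz
    rw [← hZ₄] at hz
    obtain ⟨z, hz₃, c, rfl⟩ := exists_add_smul_eq_of_mem_sup hz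
    refine A.isAlt_form.isRefl _ _ ?_
    have hzy : A.form (A.mul y y₂) z = 0 := by
      rw [← A.form_mul, hA.mul_upper_three_upper_three hz₃ hy, map_zero, LinearMap.zero_apply]
    simp [hzy, form_mul_self_right]
  rw [← hA.map_pow_three_eq h₂ h₂'] at hyy₂
  obtain ⟨u, hu, huy : A.mul u y₂ = A.mul y y₂⟩ := hyy₂
  have hyu : y - u ∈ A.upper 2 := by
    refine hA.mem_upper_two_of_mul_eq_zero h₂ h₂' (fun v hv => ?_) (by simp [huy])
    simp [A.mul_upper_pow hy hv, hA.mul_pow_three_pow_three hu hv]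
  exact hy' (by simpa using add_mem (hA.upper_two_le_pow_three hyu) hu)

theorem pow_four_eq (hA : A.IsFamily38) : A.pow 4 = A.upper 2 := by
  have := hA.finiteDimensional
  rw [← A.perp_upper 3, hA.upper_three_eq, A.upper_eq_perp 2]

theorem mul_mem_pow_five_of_mem_pow_two (hA : A.IsFamily38) {u v : L} (hu : u ∈ A.pow 2)
    (hv : v ∈ A.pow 2) : A.mul u v ∈ A.pow 5 := by
  obtain ⟨y₂, h₂, h₂'⟩ := hA.exists_mem_pow_two_notMem_pow_three
  rw [← hA.pow_three_sup_span_eq h₂ h₂'] at hu hv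
  have hmk {a b : L} : (A.pow 5).mkQ (A.mul a b) = 0 ↔ A.mul a b ∈ A.pow 5 := by simp
  have hB : (A.mul.compr₂ (A.pow 5).mkQ).IsAlt := fun x => by simp [A.mul_self]
  refine hmk.1 (apply_eq_zero_of_mem_sup_span_singleton hB (fun a ha b hb => hmk.2 ?_)
    (fun a ha => hmk.2 (hA.mul_mem_pow_five ha h₂)) hu hv)
  rw [hA.mul_pow_three_pow_three ha hb]
  exact zero_mem _

theorem mul_mem_pow_five_of_mem_upper_four (hA : A.IsFamily38) {u v : L} (hu : u ∈ A.pow 2)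
    (hv : v ∈ A.upper 4) : A.mul u v ∈ A.pow 5 := by
  have := hA.finiteDimensional
  obtain ⟨y₃, h₃, h₃'⟩ : ∃ y₃ ∈ A.upper 4, y₃ ∉ A.pow 2 := by
    refine exists_mem_notMem_of_finrank_lt ?_
    rw [hA.finrank_pow_two, hA.finrank_upper_four]
    norm_num
  have hB : (A.mul.compr₂ (A.form u)).IsAlt := fun x => by simp [A.mul_self]
  have hB₂ : ∀ a ∈ A.pow 2, ∀ b ∈ A.upper 4, A.mul.compr₂ (A.form u) a b = 0 := fun a ha b hb => by
    have h₅ := A.form_upper_pow hb (hA.mul_mem_pow_five_of_mem_pow_two ha hu)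
    rw [LinearMap.compr₂_apply, ← form_mul_comm, A.form_mul, A.form_mul, A.form_skew, h₅, neg_zero]
  rw [← A.perp_upper 4]
  intro w hw
  rw [← hA.pow_two_sup_span_eq h₃ h₃'] at hv hw
  rw [← form_mul_comm, A.form_mul, A.form_mul, form_mul_comm]
  exact apply_eq_zero_of_mem_sup_span_singleton hB
    (fun a ha b hb => hB₂ a ha b (hA.pow_two_le_upper_four hb)) (fun a ha => hB₂ a ha y₃ h₃) hv hw

end IsFamily38

end Family

section RationalForm

variable {F : Type*} [Field F] {L : Type*} [AddCommGroup L] [Module F L] {A : SympAltAlg F L}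

theorem IsTau.apply_eq {y₂ y₃ : L} {τ : End F (A.pow 5)} (hτ : A.IsTau y₂ y₃ τ) {u : L}
    (hu : u ∈ A.pow 3) {v w : A.pow 5} (hv : (v : L) = A.mul u y₂) (hw : (w : L) = A.mul u y₃) :
    τ v = w := by
  obtain ⟨φ, ψ, hφ, hψ, rfl⟩ := hτ
  obtain rfl : φ (Submodule.Quotient.mk ⟨u, hu⟩) = v := Subtype.ext ((hφ _).trans hv.symm)
  simpa using Subtype.ext ((hψ _).trans hw.symm)

theorem IsFamily38.mul_upper_two_upper_four (hA : A.IsFamily38) {z v : L} (hz : z ∈ A.upper 2)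
    (hv : v ∈ A.upper 4) : A.mul z v = 0 :=
  A.isAlt_mul.isRefl _ _ (A.mul_upper_pow hv (hA.pow_four_eq ▸ hz))

theorem IsFamily38.mem_upper_two_iff (hA : A.IsFamily38) {u y₂ : L} (hu : u ∈ A.pow 3)
    (h₂ : y₂ ∈ A.pow 2) (h₂' : y₂ ∉ A.pow 3) : u ∈ A.upper 2 ↔ A.mul u y₂ = 0 :=
  ⟨fun h => A.mul_upper_pow h h₂,
    hA.mem_upper_two_of_mul_eq_zero h₂ h₂' fun _ hv => hA.mul_pow_three_pow_three hu hv⟩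

theorem IsFamily38.exists_isTau (hA : A.IsFamily38) {y₂ y₃ : L} (h₂ : y₂ ∈ A.pow 2)
    (h₂' : y₂ ∉ A.pow 3) (h₃ : y₃ ∈ A.upper 4) : ∃ τ, A.IsTau y₂ y₃ τ := by
  let f (y : L) (hy : y ∈ A.upper 4) : A.pow 3 →ₗ[F] A.pow 5 :=
    ((A.mul.flip y).domRestrict (A.pow 3)).codRestrict (A.pow 5) fun u =>
      hA.mul_mem_pow_five_of_mem_upper_four (A.pow_succ_le 2 u.2) hy
  have hf (y : L) (hy : y ∈ A.upper 4) : (A.pow 4).submoduleOf (A.pow 3) ≤ LinearMap.ker (f y hy) :=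
    fun z hz => Subtype.ext (hA.mul_upper_two_upper_four (hA.pow_four_eq ▸ hz) hy)
  have h₂₄ := hA.pow_two_le_upper_four h₂
  have hinj : LinearMap.ker (f y₂ h₂₄) ≤ (A.pow 4).submoduleOf (A.pow 3) := fun u hu =>
    hA.pow_four_eq ▸ (hA.mem_upper_two_iff u.2 h₂ h₂').2 (congrArg Subtype.val hu)
  have hsurj : Function.Surjective (f y₂ h₂₄) := fun ⟨w, hw⟩ => by
    rw [← hA.map_pow_three_eq h₂ h₂'] at hw
    obtain ⟨u, hu, huw⟩ := hw
    exact ⟨⟨u, hu⟩, Subtype.ext huw⟩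
  let φ := LinearEquiv.ofBijective (liftQ _ (f y₂ h₂₄) (hf y₂ h₂₄))
    ⟨LinearMap.ker_eq_bot.1 (ker_liftQ_eq_bot _ _ _ hinj),
      LinearMap.range_eq_top.1 ((range_liftQ _ _ _).trans (LinearMap.range_eq_top.2 hsurj))⟩
  exact ⟨_, φ, liftQ _ (f y₃ h₃) (hf y₃ h₃), fun _ => rfl, fun _ => rfl, rfl⟩

theorem IsFamily38.isTau_ne_algebraMap (hA : A.IsFamily38) {y₂ y₃ : L} (h₂ : y₂ ∈ A.pow 2)
    (h₃ : y₃ ∈ A.upper 4) (h₃' : y₃ ∉ A.pow 2) {τ : End F (A.pow 5)} (hτ : A.IsTau y₂ y₃ τ)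
    (c : F) : τ ≠ algebraMap F _ c := by
  rintro rfl
  have hker : y₃ - c • y₂ ∈ A.upper 3 := A.mem_upper_succ_iff.2 fun u (hu : u ∈ A.pow 3) => by
    have h := congrArg Subtype.val <| hτ.apply_eq hu (v := ⟨_, hA.mul_mem_pow_five hu h₂⟩)
      (w := ⟨_, hA.mul_mem_pow_five_of_mem_upper_four (A.pow_succ_le 2 hu) h₃⟩) rfl rfl
    refine A.isAlt_mul.isRefl _ _ ?_
    rw [map_sub, map_smul, sub_eq_zero]
    exact h.symm
  rw [hA.upper_three_eq] at hker
  exact h₃' (by simpa using add_mem (A.pow_succ_le 2 hker) (smul_mem _ c h₂))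

/-- The elements `x₁, y₁ ∈ L^3`, `y₂ ∈ L^2` and `y₃ ∈ Z_4` put `τ` into rational form: `τ` maps
`y₁y₂` to `x₁y₂` and `x₁y₂` to `s • y₁y₂`, so that `τ² = s`. -/
structure IsRationalForm (A : SympAltAlg F L) (s : F) (x₁ y₁ y₂ y₃ : L) : Prop where
  x₁_mem : x₁ ∈ A.pow 3
  y₁_mem : y₁ ∈ A.pow 3
  y₂_mem : y₂ ∈ A.pow 2
  y₃_mem : y₃ ∈ A.upper 4
  form_eq_one : A.form x₁ y₁ = 1
  y₁_mul_y₃ : A.mul y₁ y₃ = A.mul x₁ y₂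
  x₁_mul_y₃ : A.mul x₁ y₃ = s • A.mul y₁ y₂
  linearIndependent : LinearIndependent F ![A.mul x₁ y₂, A.mul y₁ y₂]

theorem IsFamily38.upper_two_sup_span_eq (hA : A.IsFamily38) {u v y₂ : L} (hu : u ∈ A.pow 3)
    (hv : v ∈ A.pow 3) (h₂ : y₂ ∈ A.pow 2)
    (hli : LinearIndependent F ![A.mul u y₂, A.mul v y₂]) :
    A.upper 2 ⊔ F ∙ u ⊔ F ∙ v = A.pow 3 := by
  have := hA.finiteDimensional
  have hu' : u ∉ A.upper 2 := fun h => hli.ne_zero 0 (A.mul_upper_pow h h₂)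
  have hZu : A.upper 2 ⊔ F ∙ u ≤ A.pow 3 :=
    sup_le hA.upper_two_le_pow_three ((span_singleton_le_iff_mem _ _).2 hu)
  refine sup_span_singleton_eq hZu hv (fun h => ?_) ?_
  · obtain ⟨z, hz, c, rfl⟩ := exists_add_smul_eq_of_mem_sup h
    have hzero : A.mul z y₂ = 0 := A.mul_upper_pow hz h₂
    exact (LinearIndependent.pair_iff' (hli.ne_zero 0)).1 hli c (by simp [hzero])
  · have := finrank_lt_finrank_of_lt
      (left_lt_sup.2 fun h => hu' ((span_singleton_le_iff_mem _ _).1 h))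
    rw [hA.finrank_upper_two] at this
    rw [hA.finrank_pow_three]
    omega

theorem IsFamily38.form_ne_zero (hA : A.IsFamily38) {u v y₂ : L} (hu : u ∈ A.pow 3)
    (hv : v ∈ A.pow 3) (h₂ : y₂ ∈ A.pow 2)
    (hli : LinearIndependent F ![A.mul u y₂, A.mul v y₂]) : A.form u v ≠ 0 := fun huv => by
  have hv' : v ∈ A.upper 2 := by
    rw [A.upper_eq_perp, ← hA.upper_two_sup_span_eq hu hv h₂ hli]
    intro w hw
    obtain ⟨w, hw', c, rfl⟩ := exists_add_smul_eq_of_mem_sup hw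
    obtain ⟨z, hz, d, rfl⟩ := exists_add_smul_eq_of_mem_sup hw'
    simp [A.form_upper_pow hz hv, huv, A.form_self]
  exact hli.ne_zero 1 (A.mul_upper_pow hv' h₂)

theorem IsFamily38.isRationalForm_smul (hA : A.IsFamily38) {s : F} {x₁ y₁ y₂ y₃ : L}
    (hx₁ : x₁ ∈ A.pow 3) (hy₁ : y₁ ∈ A.pow 3) (h₂ : y₂ ∈ A.pow 2) (h₃ : y₃ ∈ A.upper 4)
    (h₁₃ : A.mul y₁ y₃ = A.mul x₁ y₂) (hx₁₃ : A.mul x₁ y₃ = s • A.mul y₁ y₂)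
    (hli : LinearIndependent F ![A.mul x₁ y₂, A.mul y₁ y₂]) :
    A.IsRationalForm ((A.form x₁ y₁)⁻¹ ^ 2 * s) ((A.form x₁ y₁)⁻¹ • x₁) y₁ y₂
      ((A.form x₁ y₁)⁻¹ • y₃) where
  x₁_mem := smul_mem _ _ hx₁
  y₁_mem := hy₁
  y₂_mem := h₂
  y₃_mem := smul_mem _ _ h₃
  form_eq_one := by simp [hA.form_ne_zero hx₁ hy₁ h₂ hli]
  y₁_mul_y₃ := by simp [h₁₃]
  x₁_mul_y₃ := by simp [hx₁₃, smul_smul, sq, mul_assoc]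
  linearIndependent := by
    refine LinearIndependent.pair_iff.2 fun a b hab => ?_
    have hl := hA.form_ne_zero hx₁ hy₁ h₂ hli
    simpa [hl] using LinearIndependent.pair_iff.1 hli (a * (A.form x₁ y₁)⁻¹) b
      (by simpa [smul_smul] using hab)

theorem IsFamily38.exists_isRationalForm (hA : A.IsFamily38) (hC : A.IsTypeC) (h2 : (2 : F) ≠ 0) :
    ∃ s x₁ y₁ y₂ y₃, ¬ IsSquare s ∧ A.IsRationalForm s x₁ y₁ y₂ y₃ := by
  have := hA.finiteDimensional
  obtain ⟨y₂, h₂, h₂', y₃, h₃, h₃', hirr⟩ := hC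
  obtain ⟨τ, hτ⟩ := hA.exists_isTau h₂ h₂' h₃
  obtain ⟨t, s, hs, hsq⟩ := exists_sub_sq_eq_of_irreducible_minpoly h2 hA.finrank_pow_five
    (hirr τ hτ) (hA.isTau_ne_algebraMap h₂ h₃ h₃' hτ)
  set T := τ - algebraMap F _ t
  have hT {u : L} (hu : u ∈ A.pow 3) {v : A.pow 5} (hv : (v : L) = A.mul u y₂) :
      A.mul u (y₃ - t • y₂) = T v := by
    have hmem := hA.mul_mem_pow_five_of_mem_upper_four (A.pow_succ_le 2 hu) h₃
    simp [T, hτ.apply_eq hu hv (w := ⟨_, hmem⟩) rfl, hv]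
  obtain ⟨y₁, h₁, h₁'⟩ : ∃ y₁ ∈ A.pow 3, y₁ ∉ A.upper 2 := by
    refine exists_mem_notMem_of_finrank_lt ?_
    rw [hA.finrank_upper_two, hA.finrank_pow_three]
    norm_num
  let v : A.pow 5 := ⟨A.mul y₁ y₂, hA.mul_mem_pow_five h₁ h₂⟩
  have hv : v ≠ 0 := fun h => h₁' ((hA.mem_upper_two_iff h₁ h₂ h₂').2 (congrArg Subtype.val h))
  obtain ⟨x₁, hx₁, hx₁v : A.mul x₁ y₂ = T v⟩ : (T v : L) ∈ (A.pow 3).map (A.mul.flip y₂) := by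
    rw [hA.map_pow_three_eq h₂ h₂']
    exact (T v).2
  have hli : LinearIndependent F ![A.mul x₁ y₂, A.mul y₁ y₂] := by
    rw [hx₁v, LinearIndependent.pair_symm_iff]
    refine LinearIndependent.pair_iff.2 fun a b hab => LinearIndependent.pair_iff.1
      (linearIndependent_pair_apply_of_sq_eq hs hsq hv) a b (Subtype.ext hab)
  have hTT : T (T v) = s • v := by simpa [sq] using DFunLike.congr_fun hsq v
  refine ⟨_, _, _, _, _, ?_, hA.isRationalForm_smul (s := s) (y₃ := y₃ - t • y₂) hx₁ h₁ h₂
    (sub_mem h₃ (smul_mem _ _ (hA.pow_two_le_upper_four h₂))) ((hT h₁ rfl).trans hx₁v.symm)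
    ((hT hx₁ hx₁v.symm).trans (congrArg Subtype.val hTT)) hli⟩
  rintro ⟨a, ha⟩
  refine hs ⟨A.form x₁ y₁ * a, ?_⟩
  have := hA.form_ne_zero hx₁ h₁ h₂ hli
  field_simp at ha
  linear_combination ha

end RationalForm

section Duality

variable {F : Type*} [Field F] {L : Type*} [AddCommGroup L] [Module F L] (A : SympAltAlg F L)

theorem exists_form_eq_ite [FiniteDimensional F L] {ι : Type*} [DecidableEq ι]
    {v : ι → L} (hv : LinearIndependent F v) :
    ∃ w : ι → L, ∀ i j, A.form (v i) (w j) = if i = j then 1 else 0 := by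
  have h (j : ι) : ∃ w, ∀ i, A.form (v i) w = if i = j then 1 else 0 := by
    obtain ⟨f, hf⟩ := LinearMap.exists_extend ((Basis.span hv).coord j)
    refine ⟨-(LinearMap.BilinForm.toDual A.form A.nondegenerate_form).symm f, fun i => ?_⟩
    have hfi := DFunLike.congr_fun hf (Basis.span hv i)
    rw [map_neg, ← A.form_skew, LinearMap.BilinForm.apply_toDual_symm_apply]
    simpa [Basis.span_apply, Finsupp.single_apply] using hfi
  choose w hw using h
  exact ⟨w, fun i j => hw j i⟩

theorem exists_mem_form_eq_one {U : Submodule F L} {y : L} (hy : y ∉ A.perp U) :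
    ∃ x ∈ U, A.form x y = 1 := by
  simp only [mem_perp, not_forall] at hy
  obtain ⟨x, hx, hxy⟩ := hy
  exact ⟨(A.form x y)⁻¹ • x, smul_mem _ _ hx, by simp [hxy]⟩

variable {ι : Type*} [Finite ι] {z w : ι → L}

theorem exists_add_form_eq_zero [DecidableEq ι]
    (hzw : ∀ i j, A.form (z i) (w j) = if i = j then 1 else 0) (u : L) :
    ∃ a ∈ span F (Set.range z), ∀ j, A.form (u + a) (w j) = 0 := by
  have := Fintype.ofFinite ι
  exact ⟨-∑ i, A.form u (w i) • z i,
    neg_mem (sum_mem fun i _ => smul_mem _ _ (subset_span ⟨i, rfl⟩)), fun j => by simp [hzw]⟩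

theorem exists_add_form_add_eq_zero [LinearOrder ι] (hz : ∀ i j, A.form (z i) (z j) = 0)
    (hzw : ∀ i j, A.form (z i) (w j) = if i = j then 1 else 0) :
    ∃ d : ι → L, (∀ i, d i ∈ span F (Set.range z)) ∧
      ∀ i j, A.form (w i + d i) (w j + d j) = 0 := by
  have := Fintype.ofFinite ι
  have hwz (i j) : A.form (w i) (z j) = if j = i then -1 else 0 := by
    rw [A.form_skew, hzw, neg_ite, neg_zero]
  refine ⟨fun i => ∑ j, (if j < i then A.form (w j) (w i) else 0) • z j,
    fun i => sum_mem fun j _ => smul_mem _ _ (subset_span ⟨j, rfl⟩), fun i k => ?_⟩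
  have key : A.form (w i) (w k) + (if i < k then - A.form (w i) (w k) else 0) +
      (if k < i then A.form (w k) (w i) else 0) = 0 := by
    rcases lt_trichotomy i k with h | rfl | h
    · simp [h, h.not_gt]
    · simp [A.form_self]
    · simp [h, h.not_gt, A.form_skew (w k)]
  simpa [-ite_smul, hz, hwz, hzw, neg_ite, add_assoc] using key

theorem mul_sub_smul_mem_upper {k : ℕ} {u v y z : L} {a b c d : F}
    (hu : u - (a • y + b • z) ∈ A.upper (k + 1)) (hv : v - (c • y + d • z) ∈ A.upper (k + 1)) :
    A.mul u v - (a * d - b * c) • A.mul y z ∈ A.upper k := by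
  have hvu := (A.upper k).neg_mem (hv (a • y + b • z))
  rw [← A.mul_skew] at hvu
  convert (A.upper k).add_mem (hu v) hvu using 1
  simp only [map_sub, map_add, map_smul, LinearMap.sub_apply, LinearMap.add_apply,
    LinearMap.smul_apply, A.mul_self, A.mul_skew z y]
  module

end Duality

section Adapted

variable {F : Type*} [Field F] {L : Type*} [AddCommGroup L] [Module F L] {A : SympAltAlg F L}
  {s : F} {x₁ y₁ y₂ y₃ : L}

theorem IsFamily38.add_mul_add (hA : A.IsFamily38) {x a y u : L} (hx : x ∈ A.pow 3)
    (ha : a ∈ A.upper 2) (hy : y ∈ A.upper 4) (hu : u ∈ A.pow 3) :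
    A.mul (x + a) (y + u) = A.mul x y := by
  simp [hA.mul_upper_two_upper_four ha hy, hA.mul_pow_three_pow_three hx hu,
    hA.mul_pow_three_pow_three (hA.upper_two_le_pow_three ha) hu]

namespace IsRationalForm

theorem add (h : A.IsRationalForm s x₁ y₁ y₂ y₃) (hA : A.IsFamily38) {a b u v : L}
    (ha : a ∈ A.upper 2) (hb : b ∈ A.upper 2) (hu : u ∈ A.pow 3) (hv : v ∈ A.pow 3) :
    A.IsRationalForm s (x₁ + a) (y₁ + b) (y₂ + u) (y₃ + v) := by
  have h₂₄ := hA.pow_two_le_upper_four h.y₂_mem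
  refine ⟨add_mem h.x₁_mem (hA.upper_two_le_pow_three ha),
    add_mem h.y₁_mem (hA.upper_two_le_pow_three hb), add_mem h.y₂_mem (A.pow_succ_le 2 hu),
    add_mem h.y₃_mem (hA.pow_two_le_upper_four (A.pow_succ_le 2 hv)), ?_, ?_, ?_, ?_⟩
  · rw [map_add, map_add, LinearMap.add_apply, LinearMap.add_apply, h.form_eq_one,
      A.form_upper_pow ha h.y₁_mem, A.form_upper_pow ha (hA.upper_two_le_pow_three hb),
      A.form_skew x₁ b, A.form_upper_pow hb h.x₁_mem]
    simp
  · rw [hA.add_mul_add h.y₁_mem hb h.y₃_mem hv, hA.add_mul_add h.x₁_mem ha h₂₄ hu, h.y₁_mul_y₃]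
  · rw [hA.add_mul_add h.x₁_mem ha h.y₃_mem hv, hA.add_mul_add h.y₁_mem hb h₂₄ hu, h.x₁_mul_y₃]
  · rw [hA.add_mul_add h.x₁_mem ha h₂₄ hu, hA.add_mul_add h.y₁_mem hb h₂₄ hu]
    exact h.linearIndependent

theorem y₂_notMem (h : A.IsRationalForm s x₁ y₁ y₂ y₃) (hA : A.IsFamily38) : y₂ ∉ A.pow 3 :=
  fun h₂ => h.linearIndependent.ne_zero 0 (hA.mul_pow_three_pow_three h.x₁_mem h₂)

theorem y₃_notMem (h : A.IsRationalForm s x₁ y₁ y₂ y₃) (hA : A.IsFamily38) : y₃ ∉ A.pow 2 := by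
  intro h₃
  rw [← hA.pow_three_sup_span_eq h.y₂_mem (h.y₂_notMem hA)] at h₃
  obtain ⟨u, hu, c, rfl⟩ := exists_add_smul_eq_of_mem_sup h₃
  have h₁ := h.y₁_mul_y₃
  rw [map_add, map_smul, hA.mul_pow_three_pow_three h.y₁_mem hu, zero_add] at h₁
  exact (LinearIndependent.pair_iff' (h.linearIndependent.ne_zero 1)).1
    (LinearIndependent.pair_symm_iff.1 h.linearIndependent) c h₁

theorem exists_smul_add_smul_add_eq (h : A.IsRationalForm s x₁ y₁ y₂ y₃) (hA : A.IsFamily38) {u : L}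
    (hu : u ∈ A.pow 3) : ∃ a b : F, ∃ z ∈ A.upper 2, a • x₁ + b • y₁ + z = u := by
  rw [← hA.upper_two_sup_span_eq h.x₁_mem h.y₁_mem h.y₂_mem h.linearIndependent] at hu
  obtain ⟨u, hu', b, rfl⟩ := exists_add_smul_eq_of_mem_sup hu
  obtain ⟨z, hz, a, rfl⟩ := exists_add_smul_eq_of_mem_sup hu'
  exact ⟨a, b, z, hz, by abel⟩

theorem pow_five_eq (h : A.IsRationalForm s x₁ y₁ y₂ y₃) (hA : A.IsFamily38) :
    A.pow 5 = span F {A.mul x₁ y₂, A.mul y₁ y₂} := by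
  refine le_antisymm ?_ (span_le.2 ?_)
  · rw [← hA.map_pow_three_eq h.y₂_mem (h.y₂_notMem hA)]
    rintro _ ⟨u, hu, rfl⟩
    obtain ⟨a, b, z, hz, rfl⟩ := h.exists_smul_add_smul_add_eq hA hu
    exact mem_span_pair.2 ⟨a, b, by simp [A.mul_upper_pow hz h.y₂_mem]⟩
  · rintro _ (rfl | rfl)
    exacts [hA.mul_mem_pow_five h.x₁_mem h.y₂_mem, hA.mul_mem_pow_five h.y₁_mem h.y₂_mem]

theorem sub_mem_upper_four (h : A.IsRationalForm s x₁ y₁ y₂ y₃) (hA : A.IsFamily38) {y₄ y₅ : L}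
    (h₄₄ : A.form (A.mul x₁ y₂) y₄ = 1) (h₅₄ : A.form (A.mul y₁ y₂) y₄ = 0)
    (h₄₅ : A.form (A.mul x₁ y₂) y₅ = 0) (h₅₅ : A.form (A.mul y₁ y₂) y₅ = 1) (u : L) :
    u - (A.form (A.mul x₁ y₂) u • y₄ + A.form (A.mul y₁ y₂) u • y₅) ∈ A.upper 4 := by
  rw [A.upper_eq_perp, h.pow_five_eq hA]
  intro v hv
  obtain ⟨a, b, rfl⟩ := mem_span_pair.1 hv
  simp only [map_add, map_sub, map_smul, LinearMap.add_apply, LinearMap.smul_apply, smul_eq_mul,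
    h₄₄, h₅₄, h₄₅, h₅₅]
  ring

theorem mul_sub_smul_mem_pow_three (h : A.IsRationalForm s x₁ y₁ y₂ y₃) (hA : A.IsFamily38)
    {y₄ y₅ : L} (h₄₄ : A.form (A.mul x₁ y₂) y₄ = 1) (h₅₄ : A.form (A.mul y₁ y₂) y₄ = 0)
    (h₄₅ : A.form (A.mul x₁ y₂) y₅ = 0) (h₅₅ : A.form (A.mul y₁ y₂) y₅ = 1) (u v : L) :
    A.mul u v - (A.form (A.mul x₁ y₂) u * A.form (A.mul y₁ y₂) v -
      A.form (A.mul y₁ y₂) u * A.form (A.mul x₁ y₂) v) • A.mul y₄ y₅ ∈ A.pow 3 := by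
  rw [← hA.upper_three_eq]
  exact A.mul_sub_smul_mem_upper (h.sub_mem_upper_four hA h₄₄ h₅₄ h₄₅ h₅₅ u)
    (h.sub_mem_upper_four hA h₄₄ h₅₄ h₄₅ h₅₅ v)

theorem mul_notMem_pow_three (h : A.IsRationalForm s x₁ y₁ y₂ y₃) (hA : A.IsFamily38) {y₄ y₅ : L}
    (h₄₄ : A.form (A.mul x₁ y₂) y₄ = 1) (h₅₄ : A.form (A.mul y₁ y₂) y₄ = 0)
    (h₄₅ : A.form (A.mul x₁ y₂) y₅ = 0) (h₅₅ : A.form (A.mul y₁ y₂) y₅ = 1) :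
    A.mul y₅ y₄ ∉ A.pow 3 := by
  intro hmem
  have hle : A.pow 2 ≤ A.pow 3 := A.prod_le fun u _ v _ => by
    have huv := h.mul_sub_smul_mem_pow_three hA h₄₄ h₅₄ h₄₅ h₅₅ u v
    rw [A.mul_skew y₄] at huv
    exact (sub_mem_iff_left _ (smul_mem _ _ (neg_mem hmem))).1 huv
  exact h.y₂_notMem hA (hle h.y₂_mem)

end IsRationalForm

/-- A rational form `x₁, y₁, y₂, y₃ = w 0` of `τ` completed to a basis `x₁, y₁, x₂, y₂, z, w` of `L`
that has all the products of a standard basis for `P_10^(3,8)(r,s)`, where `z = (x₃, x₄, x₅)` is a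
basis of the centre and `w = (y₃, y₄, y₅)` is dual to it. The basis becomes standard after
adding central elements to `x₁, y₁, x₂` and `w`. -/
structure IsAdapted (A : SympAltAlg F L) (r s : F) (x₁ y₁ x₂ y₂ : L) (z w : Fin 3 → L) : Prop
    extends A.IsRationalForm s x₁ y₁ y₂ (w 0) where
  z_mem : ∀ i, z i ∈ A.upper 1
  form_z_w : ∀ i j, A.form (z i) (w j) = if i = j then 1 else 0
  x₁_mul_y₂ : A.mul x₁ y₂ = z 1
  y₁_mul_y₂ : A.mul y₁ y₂ = z 2
  x₂_mem : x₂ ∈ A.upper 2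
  form_x₂_y₂ : A.form x₂ y₂ = 1
  form_x₁_y₂ : A.form x₁ y₂ = 0
  form_y₁_y₂ : A.form y₁ y₂ = 0
  form_y₂_y₃ : A.form y₂ (w 0) = 0
  y₂_mul_y₃ : A.mul y₂ (w 0) = 0
  y₅_mul_y₄ : A.mul (w 2) (w 1) = r • y₂

theorem IsRationalForm.exists_mul_eq_smul (h : A.IsRationalForm s x₁ y₁ y₂ y₃) (hA : A.IsFamily38) :
    ∃ r : F, r ≠ 0 ∧ ∃ y₂' y₄ y₅, A.IsRationalForm s x₁ y₁ y₂' y₃ ∧ A.mul y₅ y₄ = r • y₂' ∧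
      A.form (A.mul x₁ y₂') y₄ = 1 ∧ A.form (A.mul y₁ y₂') y₄ = 0 ∧
      A.form (A.mul x₁ y₂') y₅ = 0 ∧ A.form (A.mul y₁ y₂') y₅ = 1 := by
  have := hA.finiteDimensional
  obtain ⟨w, hw⟩ := A.exists_form_eq_ite h.linearIndependent
  have h₄₄ := hw 0 0
  have h₅₄ := hw 1 0
  have h₄₅ := hw 0 1
  have h₅₅ := hw 1 1
  have hnot := h.mul_notMem_pow_three hA h₄₄ h₅₄ h₄₅ h₅₅
  have hmem : A.mul (w 1) (w 0) ∈ A.pow 3 ⊔ F ∙ y₂ :=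
    hA.pow_three_sup_span_eq h.y₂_mem (h.y₂_notMem hA) ▸ A.mul_mem_pow_succ mem_top _
  obtain ⟨u, hu, r, hr⟩ := exists_add_smul_eq_of_mem_sup hmem
  have hr0 : r ≠ 0 := fun h0 => hnot (by simpa [← hr, h0] using hu)
  have hadd {x : L} (hx : x ∈ A.pow 3) : A.mul x (y₂ + r⁻¹ • u) = A.mul x y₂ := by
    simp [hA.mul_pow_three_pow_three hx hu]
  refine ⟨r, hr0, y₂ + r⁻¹ • u, w 0, w 1, ?_, ?_, ?_⟩
  · simpa using h.add hA (zero_mem _) (zero_mem _) (smul_mem _ r⁻¹ hu) (zero_mem _)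
  · rw [← hr, smul_add, smul_inv_smul₀ hr0, add_comm]
  · rw [hadd h.x₁_mem, hadd h.y₁_mem]
    exact ⟨h₄₄, h₅₄, h₄₅, h₅₅⟩

theorem IsRationalForm.exists_add_mul_eq_zero (h : A.IsRationalForm s x₁ y₁ y₂ y₃)
    (hA : A.IsFamily38) {x₂ : L} (hx₂ : x₂ ∈ A.upper 2) (h₂₂ : A.form x₂ y₂ = 1) :
    ∃ v ∈ A.pow 3, A.mul y₂ (y₃ + v) = 0 ∧ A.form y₂ (y₃ + v) = 0 := by
  have hmem := hA.mul_mem_pow_five_of_mem_upper_four h.y₂_mem h.y₃_mem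
  rw [← hA.map_pow_three_eq h.y₂_mem (h.y₂_notMem hA)] at hmem
  obtain ⟨u, hu, huy : A.mul u y₂ = A.mul y₂ y₃⟩ := hmem
  refine ⟨u + A.form y₂ (y₃ + u) • x₂,
    add_mem hu (smul_mem _ _ (hA.upper_two_le_pow_three hx₂)), ?_, ?_⟩
  · have h₂₂' : A.mul x₂ y₂ = 0 := A.mul_upper_pow hx₂ h.y₂_mem
    simp [A.mul_skew y₂ u, A.mul_skew y₂ x₂, huy, h₂₂']
  · simp [← add_assoc, A.form_skew y₂ x₂, h₂₂]

theorem IsRationalForm.exists_center_dual (h : A.IsRationalForm s x₁ y₁ y₂ y₃) (hA : A.IsFamily38)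
    {y₄ y₅ : L} (h₄₄ : A.form (A.mul x₁ y₂) y₄ = 1) (h₅₄ : A.form (A.mul y₁ y₂) y₄ = 0)
    (h₄₅ : A.form (A.mul x₁ y₂) y₅ = 0) (h₅₅ : A.form (A.mul y₁ y₂) y₅ = 1) :
    ∃ x₃ ∈ A.upper 1, A.form x₃ y₃ = 1 ∧ A.form x₃ y₄ = 0 ∧ A.form x₃ y₅ = 0 := by
  have := hA.finiteDimensional
  obtain ⟨x, hx, hxy⟩ := A.exists_mem_form_eq_one (U := A.upper 1)
    (A.perp_upper 1 ▸ h.y₃_notMem hA)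
  have h₄ := hA.mul_mem_pow_five h.x₁_mem h.y₂_mem
  have h₅ := hA.mul_mem_pow_five h.y₁_mem h.y₂_mem
  have h₃ {v : L} (hv : v ∈ A.pow 5) : A.form v y₃ = 0 :=
    A.isAlt_form.isRefl _ _ (A.form_upper_pow h.y₃_mem hv)
  refine ⟨x - (A.form x y₄ • A.mul x₁ y₂ + A.form x y₅ • A.mul y₁ y₂),
    sub_mem hx (hA.pow_five_le_center (add_mem (smul_mem _ _ h₄) (smul_mem _ _ h₅))), ?_, ?_, ?_⟩
  · simp [hxy, h₃ h₄, h₃ h₅]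
  · simp [h₄₄, h₅₄]
  · simp [h₄₅, h₅₅]

theorem IsRationalForm.exists_isAdapted (h : A.IsRationalForm s x₁ y₁ y₂ y₃) (hA : A.IsFamily38) :
    ∃ r : F, r ≠ 0 ∧ ∃ x₁ y₁ x₂ y₂ z w, A.IsAdapted r s x₁ y₁ x₂ y₂ z w := by
  have := hA.finiteDimensional
  obtain ⟨r, hr, y₂, y₄, y₅, h, h₅₄, hdual⟩ := h.exists_mul_eq_smul hA
  obtain ⟨x₂, hx₂, h₂₂⟩ := A.exists_mem_form_eq_one (U := A.upper 2)
    (A.perp_upper 2 ▸ h.y₂_notMem hA)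
  obtain ⟨v, hv, h₂₃, hf₂₃⟩ := h.exists_add_mul_eq_zero hA hx₂ h₂₂
  have h' := h.add hA (smul_mem _ (-A.form x₁ y₂) hx₂) (smul_mem _ (-A.form y₁ y₂) hx₂)
    (zero_mem _) hv
  have hx₂y₂ : A.mul x₂ y₂ = 0 := A.mul_upper_pow hx₂ h.y₂_mem
  have hx (x : L) (c : F) : A.mul (x + c • x₂) y₂ = A.mul x y₂ := by simp [hx₂y₂]
  rw [add_zero] at h'
  rw [← hx x₁ (-A.form x₁ y₂), ← hx y₁ (-A.form y₁ y₂)] at hdual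
  obtain ⟨h₄₄, h₅₄', h₄₅, h₅₅⟩ := hdual
  obtain ⟨x₃, hx₃, h₃₃, h₃₄, h₃₅⟩ := h'.exists_center_dual hA h₄₄ h₅₄' h₄₅ h₅₅
  have h₄ := hA.mul_mem_pow_five h'.x₁_mem h.y₂_mem
  have h₅ := hA.mul_mem_pow_five h'.y₁_mem h.y₂_mem
  have hperp {u : L} (hu : u ∈ A.pow 5) : A.form u (y₃ + v) = 0 :=
    A.isAlt_form.isRefl _ _ (A.form_upper_pow h'.y₃_mem hu)
  refine ⟨r, hr, _, _, x₂, y₂, ![x₃, _, _], ![y₃ + v, y₄, y₅],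
    { toIsRationalForm := h'
      z_mem := ?_
      form_z_w := ?_
      x₁_mul_y₂ := rfl
      y₁_mul_y₂ := rfl
      x₂_mem := hx₂
      form_x₂_y₂ := h₂₂
      form_x₁_y₂ := by simp [h₂₂]
      form_y₁_y₂ := by simp [h₂₂]
      form_y₂_y₃ := hf₂₃
      y₂_mul_y₃ := h₂₃
      y₅_mul_y₄ := h₅₄ }⟩
  · exact Fin.forall_fin_succ.2 ⟨hx₃, Fin.forall_fin_two.2
      ⟨hA.pow_five_le_center h₄, hA.pow_five_le_center h₅⟩⟩
  · intro i j
    fin_cases i <;> fin_cases j <;>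
      first | exact h₃₃ | exact h₃₄ | exact h₃₅ | exact hperp h₄ | exact hperp h₅ | assumption

theorem IsAdapted.add {r : F} {x₂ : L} {z w : Fin 3 → L} (h : A.IsAdapted r s x₁ y₁ x₂ y₂ z w)
    (hA : A.IsFamily38) {a b c : L} {d : Fin 3 → L} (ha : a ∈ A.upper 1) (hb : b ∈ A.upper 1)
    (hc : c ∈ A.upper 1) (hd : ∀ i, d i ∈ A.upper 1) :
    A.IsAdapted r s (x₁ + a) (y₁ + b) (x₂ + c) y₂ z (w + d) := by
  have h₁₂ := A.upper_mono one_le_two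
  have hmul {u : L} (hu : u ∈ A.upper 1) (v : L) : A.mul u v = 0 := hu v
  have hmul' {u : L} (hu : u ∈ A.upper 1) (v : L) : A.mul v u = 0 :=
    A.isAlt_mul.isRefl _ _ (hu v)
  have hform {u : L} (hu : u ∈ A.upper 1) : A.form u y₂ = 0 := A.form_upper_pow hu h.y₂_mem
  exact
    { toIsRationalForm := by
        simpa using h.toIsRationalForm.add hA (h₁₂ ha) (h₁₂ hb) (zero_mem _)
          (hA.center_le_pow_three (hd 0))
      z_mem := h.z_mem
      form_z_w := fun i j => by
        simp [h.form_z_w, hA.isIsotropic_center _ (h.z_mem i) _ (hd j)]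
      x₁_mul_y₂ := by simp [h.x₁_mul_y₂, hmul ha]
      y₁_mul_y₂ := by simp [h.y₁_mul_y₂, hmul hb]
      x₂_mem := add_mem h.x₂_mem (h₁₂ hc)
      form_x₂_y₂ := by simp [h.form_x₂_y₂, hform hc]
      form_x₁_y₂ := by simp [h.form_x₁_y₂, hform ha]
      form_y₁_y₂ := by simp [h.form_y₁_y₂, hform hb]
      form_y₂_y₃ := by simp [h.form_y₂_y₃, A.form_skew y₂ (d 0), hform (hd 0)]
      y₂_mul_y₃ := by simp [h.y₂_mul_y₃, hmul' (hd 0)]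
      y₅_mul_y₄ := by simp [h.y₅_mul_y₄, hmul (hd 2), hmul' (hd 1)] }

end Adapted

section SymplecticFamily

variable {F : Type*} [Field F] {L : Type*} [AddCommGroup L] [Module F L] {A : SympAltAlg F L}
  {M : Type*} [AddCommGroup M] [Module F M] {B : SympAltAlg F M}

/-- Two families with the Gram matrix of a standard basis. -/
structure IsSymplecticFamily {ι : Type*} [DecidableEq ι] (A : SympAltAlg F L) (x y : ι → L) :
    Prop where
  form_xx : ∀ i j, A.form (x i) (x j) = 0
  form_yy : ∀ i j, A.form (y i) (y j) = 0
  form_xy : ∀ i j, A.form (x i) (y j) = if i = j then 1 else 0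

namespace IsSymplecticFamily

theorem form_yx {ι : Type*} [DecidableEq ι] {x y : ι → L} (h : A.IsSymplecticFamily x y) (i j : ι) :
    A.form (y i) (x j) = -if j = i then 1 else 0 := by
  rw [A.form_skew, h.form_xy]

theorem linearIndependent {ι : Type*} [Finite ι] [DecidableEq ι] {x y : ι → L}
    (h : A.IsSymplecticFamily x y) : LinearIndependent F (Sum.elim x y) := by
  have := Fintype.ofFinite ι
  refine Fintype.linearIndependent_iff.2 fun g hg => ?_
  rw [Fintype.sum_sum_type] at hg
  rintro (j | j)
  · simpa [h.form_xy, h.form_yy] using congrArg (A.form · (y j)) hg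
  · simpa [h.form_yx, h.form_xx] using congrArg (A.form · (x j)) hg

theorem exists_isStandardBasis [FiniteDimensional F L] {n : ℕ} {x y : Fin n → L}
    (h : A.IsSymplecticFamily x y) (hL : finrank F L = 2 * n) :
    ∃ b : Basis (Fin n ⊕ Fin n) F L, A.IsStandardBasis b ∧ b = Sum.elim x y := by
  have hcard : Fintype.card (Fin n ⊕ Fin n) = finrank F L := by
    rw [hL, Fintype.card_sum, Fintype.card_fin, two_mul]
  have hspan := h.linearIndependent.span_eq_top_of_card_eq_finrank' hcard
  refine ⟨Basis.mk h.linearIndependent hspan.ge, ⟨?_, ?_, ?_⟩, Basis.coe_mk _ _⟩ <;>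
    simp only [Basis.mk_apply, Sum.elim_inl, Sum.elim_inr]
  exacts [h.form_xx, h.form_yy, h.form_xy]

end IsSymplecticFamily

theorem form_mul_eq_of_lt {ι : Type*} [LinearOrder ι] {v : ι → L} {v' : ι → M}
    (h : ∀ i j k, i < j → j < k →
      A.form (A.mul (v i) (v j)) (v k) = B.form (B.mul (v' i) (v' j)) (v' k)) (i j k : ι) :
    A.form (A.mul (v i) (v j)) (v k) = B.form (B.mul (v' i) (v' j)) (v' k) := by
  have hrot {i j k} (h : A.form (A.mul (v i) (v j)) (v k) = B.form (B.mul (v' i) (v' j)) (v' k)) :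
      A.form (A.mul (v j) (v k)) (v i) = B.form (B.mul (v' j) (v' k)) (v' i) := by
    rw [← A.form_mul, h, B.form_mul]
  have hswap {i j k} (h : A.form (A.mul (v i) (v j)) (v k) = B.form (B.mul (v' i) (v' j)) (v' k)) :
      A.form (A.mul (v j) (v i)) (v k) = B.form (B.mul (v' j) (v' i)) (v' k) := by
    rw [A.form_mul_swap, h, ← B.form_mul_swap]
  have hself (i k) : A.form (A.mul (v i) (v i)) (v k) = B.form (B.mul (v' i) (v' i)) (v' k) := by
    simp [A.mul_self, B.mul_self]
  rcases lt_trichotomy i j with hij | rfl | hij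
  · rcases lt_trichotomy j k with hjk | rfl | hjk
    · exact h i j k hij hjk
    · exact hrot (hrot (hself j i))
    · rcases lt_trichotomy i k with hik | rfl | hik
      · exact hswap (hrot (hrot (h i k j hik hjk)))
      · exact hrot (hself i j)
      · exact hrot (h k i j hik hij)
  · exact hself i k
  · rcases lt_trichotomy j k with hjk | rfl | hjk
    · rcases lt_trichotomy i k with hik | rfl | hik
      · exact hswap (h j i k hij hik)
      · exact hrot (hself i j)
      · exact hrot (hrot (h j k i hjk hik))
    · exact hrot (hrot (hself j i))
    · exact hswap (hrot (h k j i hjk hij))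

theorem IsPresentedBy.form_mul_eq {n : ℕ} {b : Basis (Fin n ⊕ Fin n) F L}
    {b' : Basis (Fin n ⊕ Fin n) F M} {P : NilpPres F n} (hA : A.IsPresentedBy b P)
    (hB : B.IsPresentedBy b' P) (p q t : Fin n ⊕ Fin n) :
    A.form (A.mul (b p) (b q)) (b t) = B.form (B.mul (b' p) (b' q)) (b' t) := by
  refine form_mul_eq_of_lt (v := b ∘ ofLex) (v' := b' ∘ ofLex) ?_ (toLex p) (toLex q) (toLex t)
  simp only [Lex.forall, Sum.forall, Sum.Lex.inl_lt_inl_iff, Sum.Lex.inr_lt_inr_iff,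
    Sum.Lex.not_inr_lt_inl, Sum.Lex.inl_lt_inr, Function.comp_apply, ofLex_toLex]
  refine ⟨fun i => ⟨fun j => ⟨fun k _ _ => ?_, fun k _ _ => ?_⟩,
    fun j => ⟨by simp, fun k _ hjk => ?_⟩⟩,
    fun i => ⟨by simp, fun j => ⟨by simp, fun k hij hjk => ?_⟩⟩⟩
  · rw [hA.xxx_zero, hB.xxx_zero]
  · rw [hA.xxy_zero, hB.xxy_zero]
  · rcases lt_or_ge i j with hij | hij
    · rw [hA.xyy _ _ _ hij hjk, hB.xyy _ _ _ hij hjk]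
    · rw [hA.xyy_zero _ _ _ hij hjk, hB.xyy_zero _ _ _ hij hjk]
  · rw [hA.yyy _ _ _ hij hjk, hB.yyy _ _ _ hij hjk]

theorem IsPresentedBy.nonempty_iso {n : ℕ} {b : Basis (Fin n ⊕ Fin n) F L}
    {b' : Basis (Fin n ⊕ Fin n) F M} {P : NilpPres F n} (hA : A.IsPresentedBy b P)
    (hB : B.IsPresentedBy b' P) : Nonempty (Iso A B) := by
  let e := b.equiv b' (Equiv.refl _)
  have he (p) : e (b p) = b' p := by simp [e]
  have hform : B.form.compl₁₂ e.toLinearMap e.toLinearMap = A.form :=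
    b.ext fun p => b.ext fun q => by
      have hA := hA.standard
      have hB := hB.standard
      rcases p with i | i <;> rcases q with j | j <;>
        simp [he, hA.form_xx, hB.form_xx, hA.form_yy, hB.form_yy, hA.form_xy, hB.form_xy,
          A.form_skew (b (.inr i)) (b (.inl j)), B.form_skew (b' (.inr i)) (b' (.inl j))]
  have hform' (u v) : B.form (e u) (e v) = A.form u v := LinearMap.congr_fun₂ hform u v
  have htriple : (B.mul.compl₁₂ e.toLinearMap e.toLinearMap).compr₂
      (B.form.compl₂ e.toLinearMap) = A.mul.compr₂ A.form :=
    b.ext fun p => b.ext fun q => b.ext fun t => by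
      simpa [he] using (hA.form_mul_eq hB p q t).symm
  refine ⟨e, fun u v => B.eq_of_form_eq fun w => ?_, hform'⟩
  obtain ⟨w, rfl⟩ := e.surjective w
  rw [hform']
  exact (LinearMap.congr_fun (LinearMap.congr_fun₂ htriple u v) w).symm

end SymplecticFamily

section Table

variable {F : Type*} [Field F] {L : Type*} [AddCommGroup L] [Module F L] {A : SympAltAlg F L}
  {M : Type*} [AddCommGroup M] [Module F M] {B : SympAltAlg F M} {r s : F} {x y : Fin 5 → L}

/-- The multiplication table of a standard basis `x₁, …, x₅, y₁, …, y₅` for `P_10^(3,8)(r,s)`,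
without the products that follow from the invariance of the triple form. The field names count
from `1` as the paper does, the indices of `x` and `y` from `0`. -/
structure IsTable38 (A : SympAltAlg F L) (r s : F) (x y : Fin 5 → L) : Prop
    extends A.IsSymplecticFamily x y where
  x₃_mem : x 2 ∈ A.upper 1
  x₄_mem : x 3 ∈ A.upper 1
  x₅_mem : x 4 ∈ A.upper 1
  x₁_mul_x₂ : A.mul (x 0) (x 1) = 0
  x₁_mul_y₁ : A.mul (x 0) (y 0) = 0
  x₂_mul_y₁ : A.mul (x 1) (y 0) = 0
  x₂_mul_y₂ : A.mul (x 1) (y 1) = 0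
  x₂_mul_y₃ : A.mul (x 1) (y 2) = 0
  y₂_mul_y₃ : A.mul (y 1) (y 2) = 0
  x₁_mul_y₂ : A.mul (x 0) (y 1) = x 3
  y₁_mul_y₃ : A.mul (y 0) (y 2) = x 3
  y₁_mul_y₂ : A.mul (y 0) (y 1) = x 4
  x₁_mul_y₃ : A.mul (x 0) (y 2) = s • x 4
  y₅_mul_y₄ : A.mul (y 4) (y 3) = r • y 1

theorem IsAdapted.form_y₂_eq_zero {x₁ y₁ x₂ y₂ : L} {z w : Fin 3 → L}
    (h : A.IsAdapted r s x₁ y₁ x₂ y₂ z w) (hr : r ≠ 0) (j : Fin 3) : A.form y₂ (w j) = 0 := by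
  have h₅₄ (v : L) : A.form y₂ v = r⁻¹ * A.form (A.mul (w 2) (w 1)) v := by
    simp [h.y₅_mul_y₄, hr]
  obtain rfl | rfl | rfl : j = 0 ∨ j = 1 ∨ j = 2 := by omega
  · exact h.form_y₂_y₃
  · rw [h₅₄, A.form_mul_self_right, mul_zero]
  · rw [h₅₄, A.form_mul_swap, A.form_mul_self_right, neg_zero, mul_zero]

theorem IsAdapted.isSymplecticFamily {x₁ y₁ x₂ y₂ : L} {z w : Fin 3 → L}
    (h : A.IsAdapted r s x₁ y₁ x₂ y₂ z w) (hA : A.IsFamily38) (hr : r ≠ 0)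
    (hw : ∀ i j, A.form (w i) (w j) = 0) (hx₁ : ∀ j, A.form x₁ (w j) = 0)
    (hy₁ : ∀ j, A.form y₁ (w j) = 0) (hx₂ : ∀ j, A.form x₂ (w j) = 0) :
    A.IsSymplecticFamily ![x₁, x₂, z 0, z 1, z 2] ![y₁, y₂, w 0, w 1, w 2] := by
  have h₃₂ := A.pow_succ_le 2
  have h₂₁ := A.form_upper_pow h.x₂_mem h.x₁_mem
  have h₂₁' := A.form_upper_pow h.x₂_mem h.y₁_mem
  have hz {v : L} (hv : v ∈ A.pow 2) (i) : A.form (z i) v = 0 := A.form_upper_pow (h.z_mem i) hv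
  have hzx₁ := hz (h₃₂ h.x₁_mem)
  have hzx₂ := hz (h₃₂ (hA.upper_two_le_pow_three h.x₂_mem))
  have hzy₁ := hz (h₃₂ h.y₁_mem)
  have hzy₂ := hz h.y₂_mem
  have hzz (i j) : A.form (z i) (z j) = 0 := hz (h₃₂ (hA.center_le_pow_three (h.z_mem j))) i
  constructor <;> intro i j
  · fin_cases i <;> fin_cases j <;>
      simp [A.form_self, h₂₁, A.form_skew x₁, A.form_skew x₂ (z _), hzx₁, hzx₂, hzz]
  · fin_cases i <;> fin_cases j <;>
      simp [A.form_self, h.form_y₁_y₂, A.form_skew y₂ y₁, A.form_skew (w _) y₁,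
        A.form_skew (w _) y₂, hy₁, h.form_y₂_eq_zero hr, hw]
  · fin_cases i <;> fin_cases j <;>
      simp [h.form_eq_one, h.form_x₁_y₂, hx₁, h₂₁', h.form_x₂_y₂, hx₂, hzy₁, hzy₂, h.form_z_w]

theorem IsAdapted.isTable38 {x₁ y₁ x₂ y₂ : L} {z w : Fin 3 → L}
    (h : A.IsAdapted r s x₁ y₁ x₂ y₂ z w) (hA : A.IsFamily38) (hr : r ≠ 0)
    (hw : ∀ i j, A.form (w i) (w j) = 0) (hx₁ : ∀ j, A.form x₁ (w j) = 0)
    (hy₁ : ∀ j, A.form y₁ (w j) = 0) (hx₂ : ∀ j, A.form x₂ (w j) = 0) :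
    A.IsTable38 r s ![x₁, x₂, z 0, z 1, z 2] ![y₁, y₂, w 0, w 1, w 2] where
  toIsSymplecticFamily := h.isSymplecticFamily hA hr hw hx₁ hy₁ hx₂
  x₃_mem := h.z_mem 0
  x₄_mem := h.z_mem 1
  x₅_mem := h.z_mem 2
  x₁_mul_x₂ := hA.mul_pow_three_pow_three h.x₁_mem (hA.upper_two_le_pow_three h.x₂_mem)
  x₁_mul_y₁ := hA.mul_pow_three_pow_three h.x₁_mem h.y₁_mem
  x₂_mul_y₁ := hA.mul_pow_three_pow_three (hA.upper_two_le_pow_three h.x₂_mem) h.y₁_mem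
  x₂_mul_y₂ := A.mul_upper_pow h.x₂_mem h.y₂_mem
  x₂_mul_y₃ := hA.mul_upper_two_upper_four h.x₂_mem h.y₃_mem
  y₂_mul_y₃ := h.y₂_mul_y₃
  x₁_mul_y₂ := h.x₁_mul_y₂
  y₁_mul_y₃ := h.y₁_mul_y₃.trans h.x₁_mul_y₂
  y₁_mul_y₂ := h.y₁_mul_y₂
  x₁_mul_y₃ := h.x₁_mul_y₃.trans (congrArg (s • ·) h.y₁_mul_y₂)
  y₅_mul_y₄ := h.y₅_mul_y₄

theorem IsTable38.map (h : A.IsTable38 r s x y) (e : Iso A B) :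
    B.IsTable38 r s (e.toLinearEquiv ∘ x) (e.toLinearEquiv ∘ y) := by
  have hc {u : L} (hu : u ∈ A.upper 1) : e.toLinearEquiv u ∈ B.upper 1 := fun v => by
    obtain ⟨v, rfl⟩ := e.toLinearEquiv.surjective v
    have huv : A.mul u v = 0 := hu v
    rw [← e.map_mul, huv, map_zero]
    exact zero_mem _
  constructor
  · constructor <;> intro i j <;> simp [e.map_form, h.form_xx, h.form_yy, h.form_xy]
  · exact hc h.x₃_mem
  · exact hc h.x₄_mem
  · exact hc h.x₅_mem
  all_goals simp only [Function.comp_apply, ← e.map_mul, ← map_smul]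
  exacts [h.x₁_mul_x₂ ▸ map_zero _, h.x₁_mul_y₁ ▸ map_zero _, h.x₂_mul_y₁ ▸ map_zero _,
    h.x₂_mul_y₂ ▸ map_zero _, h.x₂_mul_y₃ ▸ map_zero _, h.y₂_mul_y₃ ▸ map_zero _,
    congrArg _ h.x₁_mul_y₂, congrArg _ h.y₁_mul_y₃, congrArg _ h.y₁_mul_y₂,
    congrArg _ h.x₁_mul_y₃, congrArg _ h.y₅_mul_y₄]

theorem IsTable38.x_mul_eq_zero (h : A.IsTable38 r s x y) {i : Fin 5} (hi : 2 ≤ i) (v : L) :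
    A.mul (x i) v = 0 := by
  obtain rfl | rfl | rfl : i = 2 ∨ i = 3 ∨ i = 4 := by omega
  exacts [h.x₃_mem v, h.x₄_mem v, h.x₅_mem v]

theorem IsTable38.x_mul_x (h : A.IsTable38 r s x y) (i j : Fin 5) : A.mul (x i) (x j) = 0 := by
  by_cases hi : 2 ≤ i
  · exact h.x_mul_eq_zero hi _
  by_cases hj : 2 ≤ j
  · exact A.isAlt_mul.isRefl _ _ (h.x_mul_eq_zero hj _)
  rcases (by omega : i = j ∨ (i = 0 ∧ j = 1) ∨ (i = 1 ∧ j = 0)) with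
    rfl | ⟨rfl, rfl⟩ | ⟨rfl, rfl⟩
  exacts [A.mul_self _, h.x₁_mul_x₂, A.isAlt_mul.isRefl _ _ h.x₁_mul_x₂]

theorem IsTable38.x_mul_y_of_le (h : A.IsTable38 r s x y) {i j : Fin 5} (hji : j ≤ i) :
    A.mul (x i) (y j) = 0 := by
  by_cases hi : 2 ≤ i
  · exact h.x_mul_eq_zero hi _
  rcases (by omega : (i = 0 ∧ j = 0) ∨ (i = 1 ∧ j = 0) ∨ (i = 1 ∧ j = 1)) with
    ⟨rfl, rfl⟩ | ⟨rfl, rfl⟩ | ⟨rfl, rfl⟩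
  exacts [h.x₁_mul_y₁, h.x₂_mul_y₁, h.x₂_mul_y₂]

theorem IsTable38.form_mul_y₄_y₅ (h : A.IsTable38 r s x y) (u : L) :
    A.form (A.mul u (y 3)) (y 4) = r * A.form u (y 1) := by
  rw [A.form_mul_comm, h.y₅_mul_y₄, map_smul, smul_eq_mul]

theorem IsTable38.isPresentedBy (h : A.IsTable38 r s x y) {b : Basis (Fin 5 ⊕ Fin 5) F L}
    (hb : A.IsStandardBasis b) (hbxy : b = Sum.elim x y) :
    A.IsPresentedBy b (NilpPres.P38 r s) := by
  have hcases {i j k : Fin 5} (hij : i < j) (hjk : j < k) :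
      (j = 3 ∧ k = 4) ∨ (i = 0 ∧ j = 1) ∨ (i = 0 ∧ j = 2) ∨ (i = 1 ∧ j = 2) := by omega
  refine ⟨hb, ?_, ?_, ?_, ?_, ?_⟩ <;> intro i j k <;> simp only [hbxy, Sum.elim_inl, Sum.elim_inr]
  · intro hij hjk
    rcases hcases hij hjk with ⟨rfl, rfl⟩ | ⟨rfl, rfl⟩ | ⟨rfl, rfl⟩ | ⟨rfl, rfl⟩
    · simp [h.form_mul_y₄_y₅, h.form_xy, NilpPres.P38]
    · simp [h.x₁_mul_y₂, h.form_xy, NilpPres.P38, eq_comm]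
    · simp [h.x₁_mul_y₃, h.form_xy, NilpPres.P38, eq_comm]
    · simp [h.x₂_mul_y₃, NilpPres.P38]
  · intro hij hjk
    rcases hcases hij hjk with ⟨rfl, rfl⟩ | ⟨rfl, rfl⟩ | ⟨rfl, rfl⟩ | ⟨rfl, rfl⟩
    · simp [h.form_mul_y₄_y₅, h.form_yy, NilpPres.P38]
    · simp [h.y₁_mul_y₂, h.form_xy, NilpPres.P38, eq_comm]
    · simp [h.y₁_mul_y₃, h.form_xy, NilpPres.P38, eq_comm]
    · simp [h.y₂_mul_y₃, NilpPres.P38]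
  · intro hji _
    rw [h.x_mul_y_of_le hji, LinearMap.map_zero₂]
  all_goals rw [h.x_mul_x, LinearMap.map_zero₂]

theorem triple_P38 (r s : F) (u v w : Fin 5 ⊕ Fin 5 → F) :
    (NilpPres.P38 r s).triple u v w =
      r * NilpPres.minor (.inl 1) (.inr 3) (.inr 4) u v w +
      s * NilpPres.minor (.inl 0) (.inr 2) (.inr 4) u v w +
      NilpPres.minor (.inl 0) (.inr 1) (.inr 3) u v w +
      NilpPres.minor (.inr 0) (.inr 1) (.inr 4) u v w +
      NilpPres.minor (.inr 0) (.inr 2) (.inr 3) u v w := by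
  simp only [NilpPres.triple, NilpPres.P38, Fin.sum_univ_five]
  simp only [Fin.isValue, lt_self_iff_false, and_self, ↓reduceIte, zero_lt_one, and_true, add_zero,
    Fin.reduceLT, not_lt_zero, and_false, zero_ne_one, Fin.reduceEq, zero_mul, one_mul, zero_add,
    Fin.lt_one_iff, Nat.reduceAdd, one_ne_zero]
  ring

theorem minor_eq {ι : Type*} (p q t : ι) (u v w : ι → F) :
    NilpPres.minor p q t u v w = u p * (v q * w t - v t * w q) - u q * (v p * w t - v t * w p) +
      u t * (v p * w q - v q * w p) := by
  simp only [NilpPres.minor, Matrix.det_fin_three, Fin.isValue, Matrix.of_apply, Matrix.cons_val',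
    Matrix.cons_val_zero, Matrix.cons_val_fin_one, Matrix.cons_val_one, Matrix.cons_val]
  ring

theorem mul_P38 (r s : F) (u v : Fin 5 ⊕ Fin 5 → F) :
    (NilpPres.P38 r s).algebra.mul u v =
      let m p q := u p * v q - u q * v p
      Sum.elim ![m (.inr 1) (.inr 4) + m (.inr 2) (.inr 3),
          -(m (.inl 0) (.inr 3) + m (.inr 0) (.inr 4)),
          -(s * m (.inl 0) (.inr 4) + m (.inr 0) (.inr 3)),
          m (.inl 0) (.inr 1) + m (.inr 0) (.inr 2) - r * m (.inl 1) (.inr 4),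
          r * m (.inl 1) (.inr 3) + s * m (.inl 0) (.inr 2) + m (.inr 0) (.inr 1)]
        ![-(s * m (.inr 2) (.inr 4) + m (.inr 1) (.inr 3)), -(r * m (.inr 3) (.inr 4)),
          0, 0, 0] := by
  have hx (i) : (NilpPres.P38 r s).algebra.mul u v (.inl i) =
      (NilpPres.P38 r s).triple u v (Pi.single (.inr i) 1) := rfl
  have hy (i) : (NilpPres.P38 r s).algebra.mul u v (.inr i) =
      -(NilpPres.P38 r s).triple u v (Pi.single (.inl i) 1) := rfl
  ext (i | i)
  · rw [hx, triple_P38]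
    fin_cases i <;> simp [minor_eq] <;> ring
  · rw [hy, triple_P38]
    fin_cases i <;> simp [-mul_eq_mul_left_iff, minor_eq] <;> ring

theorem isTable38_single (r s : F) : (NilpPres.P38 r s).algebra.IsTable38 r s
    (fun i => Pi.single (.inl i) 1) (fun i => Pi.single (.inr i) 1) := by
  have hform (u v) : (NilpPres.P38 r s).algebra.form u v =
      ∑ i, (u (.inl i) * v (.inr i) - u (.inr i) * v (.inl i)) := rfl
  constructor
  · constructor <;> intro i j <;> simp [hform, Pi.single_apply, eq_comm]
  iterate 3
    intro v
    rw [mul_P38]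
    convert (zero_mem _ : (0 : Fin 5 ⊕ Fin 5 → F) ∈ (NilpPres.P38 r s).algebra.upper 0)
    ext (i | i) <;> fin_cases i <;> simp
  all_goals
    rw [mul_P38]
    ext (i | i) <;> fin_cases i <;> simp

end Table

section Presentation

variable {F : Type*} [Field F] {L : Type*} [AddCommGroup L] [Module F L] {A : SympAltAlg F L}
  {M : Type*} [AddCommGroup M] [Module F M] {B : SympAltAlg F M} {r s : F} {x y : Fin 5 → L}

theorem IsAdapted.exists_isTable38 {x₁ y₁ x₂ y₂ : L} {z w : Fin 3 → L}
    (h : A.IsAdapted r s x₁ y₁ x₂ y₂ z w) (hA : A.IsFamily38) (hr : r ≠ 0) :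
    ∃ x y, A.IsTable38 r s x y := by
  have hspan : span F (Set.range z) ≤ A.upper 1 := span_le.2 (Set.range_subset_iff.2 h.z_mem)
  obtain ⟨d, hd, hww⟩ := A.exists_add_form_add_eq_zero
    (fun i j => hA.isIsotropic_center _ (h.z_mem i) _ (h.z_mem j)) h.form_z_w
  have h' := h.add hA (zero_mem _) (zero_mem _) (zero_mem _) fun i => hspan (hd i)
  simp only [add_zero] at h'
  obtain ⟨a, ha, hx₁⟩ := A.exists_add_form_eq_zero h'.form_z_w x₁
  obtain ⟨b, hb, hy₁⟩ := A.exists_add_form_eq_zero h'.form_z_w y₁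
  obtain ⟨c, hc, hx₂⟩ := A.exists_add_form_eq_zero h'.form_z_w x₂
  have h'' := h'.add hA (hspan ha) (hspan hb) (hspan hc) fun _ => zero_mem _
  change A.IsAdapted r s _ _ _ _ _ (w + d + 0) at h''
  rw [add_zero] at h''
  exact ⟨_, _, h''.isTable38 hA hr hww hx₁ hy₁ hx₂⟩

theorem IsTable38.hasPresentation [FiniteDimensional F L] (h : A.IsTable38 r s x y)
    (hL : finrank F L = 10) : A.HasPresentation (NilpPres.P38 r s) := by
  obtain ⟨b, hb, hbxy⟩ := h.toIsSymplecticFamily.exists_isStandardBasis hL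
  exact ⟨b, h.isPresentedBy hb hbxy⟩

theorem IsFamily38.hasPresentation (hA : A.IsFamily38) (hC : A.IsTypeC) (h2 : (2 : F) ≠ 0) :
    ∃ r s : F, r ≠ 0 ∧ ¬ IsSquare s ∧ A.HasPresentation (NilpPres.P38 r s) := by
  have := hA.finiteDimensional
  obtain ⟨s, _, _, _, _, hs, hform⟩ := hA.exists_isRationalForm hC h2
  obtain ⟨r, hr, _, _, _, _, _, _, hadapted⟩ := hform.exists_isAdapted hA
  obtain ⟨x, y, h⟩ := hadapted.exists_isTable38 hA hr
  exact ⟨r, s, hr, hs, h.hasPresentation hA.finrank_eq⟩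

theorem IsTable38.describeSame {r' s' : F} {x y : Fin 5 → Fin 5 ⊕ Fin 5 → F}
    (h : (NilpPres.P38 r s).algebra.IsTable38 r' s' x y) :
    (NilpPres.P38 r' s').DescribeSame (NilpPres.P38 r s) := by
  have hdim : finrank F (Fin 5 ⊕ Fin 5 → F) = 10 := by simp
  obtain ⟨_, hb⟩ := (isTable38_single r' s').hasPresentation hdim
  obtain ⟨_, hb'⟩ := h.hasPresentation hdim
  exact hb.nonempty_iso hb'

theorem IsTable38.smul (h : A.IsTable38 r s x y) {c k : F} (hk : c * k = 1) :
    A.IsTable38 (c ^ 3 * r) s ![x 0, c • x 1, c • x 2, k • x 3, k • x 4]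
      ![y 0, k • y 1, k • y 2, c • y 3, c • y 4] where
  form_xx i j := by fin_cases i <;> fin_cases j <;> simp [h.form_xx]
  form_yy i j := by fin_cases i <;> fin_cases j <;> simp [h.form_yy]
  form_xy i j := by fin_cases i <;> fin_cases j <;> simp [h.form_xy, hk, mul_comm k]
  x₃_mem := smul_mem _ _ h.x₃_mem
  x₄_mem := smul_mem _ _ h.x₄_mem
  x₅_mem := smul_mem _ _ h.x₅_mem
  x₁_mul_x₂ := by simp [h.x₁_mul_x₂]
  x₁_mul_y₁ := by simp [h.x₁_mul_y₁]
  x₂_mul_y₁ := by simp [h.x₂_mul_y₁]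
  x₂_mul_y₂ := by simp [h.x₂_mul_y₂]
  x₂_mul_y₃ := by simp [h.x₂_mul_y₃]
  y₂_mul_y₃ := by simp [h.y₂_mul_y₃]
  x₁_mul_y₂ := by simp [h.x₁_mul_y₂]
  y₁_mul_y₃ := by simp [h.y₁_mul_y₃]
  y₁_mul_y₂ := by simp [h.y₁_mul_y₂]
  x₁_mul_y₃ := by simp [h.x₁_mul_y₃, smul_smul, mul_comm]
  y₅_mul_y₄ := by
    have hpow : c * (c * r) = c ^ 3 * r * k := by
      linear_combination -(c ^ 2 * r) * hk
    simp [h.y₅_mul_y₄, smul_smul, hpow]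

theorem IsTable38.mix (h : A.IsTable38 r s x y) {d e D : F} (hD : (d ^ 2 - e ^ 2 * s) * D = 1) :
    A.IsTable38 r (s * D ^ 2)
      ![D • (d • x 0 + (e * s) • y 0), x 1, (d ^ 2 - e ^ 2 * s) • x 2,
        D • (d • x 3 + (e * s) • x 4), e • x 3 + d • x 4]
      ![e • x 0 + d • y 0, y 1, D • y 2, d • y 3 - e • y 4, D • (d • y 4 - (e * s) • y 3)] := by
  refine ⟨⟨fun i j => ?_, fun i j => ?_, fun i j => ?_⟩, ?_, ?_, ?_, ?_, ?_, ?_, ?_, ?_, ?_,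
    ?_, ?_, ?_, ?_, ?_⟩
  · fin_cases i <;> fin_cases j <;>
      simp [h.form_xx, h.form_yy, h.form_xy, h.form_yx, mul_comm, mul_left_comm]
  · fin_cases i <;> fin_cases j <;>
      simp [h.form_xx, h.form_yy, h.form_xy, h.form_yx, mul_comm]
  · fin_cases i <;> fin_cases j <;>
      simp [-mul_eq_zero, h.form_xx, h.form_yy, h.form_xy, h.form_yx] <;> grind
  · exact smul_mem _ _ h.x₃_mem
  · exact smul_mem _ _ (add_mem (smul_mem _ _ h.x₄_mem) (smul_mem _ _ h.x₅_mem))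
  · exact add_mem (smul_mem _ _ h.x₄_mem) (smul_mem _ _ h.x₅_mem)
  · simp [h.x₁_mul_x₂, A.mul_skew (y 0), h.x₂_mul_y₁]
  · simp [h.x₁_mul_y₁, A.mul_self, A.mul_skew (y 0)]
  · simp [A.mul_skew (x 1) (x 0), h.x₁_mul_x₂, h.x₂_mul_y₁]
  · simp [h.x₂_mul_y₂]
  · simp [h.x₂_mul_y₃]
  · simp [h.y₂_mul_y₃]
  · simp [h.x₁_mul_y₂, h.y₁_mul_y₂]
  · simp [h.x₁_mul_y₃, h.y₁_mul_y₃, smul_smul, add_comm]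
  · simp [h.x₁_mul_y₂, h.y₁_mul_y₂]
  · simp only [Fin.isValue, smul_add, Matrix.cons_val_zero, map_add, map_smul, Matrix.cons_val,
      LinearMap.add_apply, LinearMap.smul_apply, h.x₁_mul_y₃, h.y₁_mul_y₃]
    module
  · simp only [Fin.isValue, Matrix.cons_val, map_smul, map_sub, LinearMap.smul_apply,
      LinearMap.sub_apply, h.y₅_mul_y₄, A.mul_self, smul_zero, sub_zero, A.mul_skew (y 3), zero_sub,
      Matrix.cons_val_one, Matrix.cons_val_zero]
    linear_combination (norm := module) (r * hD) • y 1

end Presentation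

section Model

variable {F : Type*} [Field F] {r s : F}

theorem pow_two_P38_le : (NilpPres.P38 r s).algebra.pow 2 ≤
    Submodule.pi {.inr 2, .inr 3, .inr 4} fun _ => ⊥ :=
  prod_le _ fun u _ v _ => by
    rw [mul_P38]
    simp

theorem pow_three_P38_le : (NilpPres.P38 r s).algebra.pow 3 ≤
    Submodule.pi {.inr 1, .inr 2, .inr 3, .inr 4} fun _ => ⊥ :=
  prod_le _ fun u hu v _ => by
    have := pow_two_P38_le hu
    rw [mul_P38]
    simp_all

theorem pow_four_P38_le : (NilpPres.P38 r s).algebra.pow 4 ≤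
    Submodule.pi {.inl 0, .inr 0, .inr 1, .inr 2, .inr 3, .inr 4} fun _ => ⊥ :=
  prod_le _ fun u hu v _ => by
    have := pow_three_P38_le hu
    rw [mul_P38]
    simp_all

theorem pow_five_P38_le : (NilpPres.P38 r s).algebra.pow 5 ≤
    Submodule.pi {.inl 0, .inl 1, .inl 2, .inr 0, .inr 1, .inr 2, .inr 3, .inr 4} fun _ => ⊥ :=
  prod_le _ fun u hu v _ => by
    have := pow_four_P38_le hu
    rw [mul_P38]
    simp_all

theorem pow_six_P38 : (NilpPres.P38 r s).algebra.pow 6 = ⊥ :=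
  le_bot_iff.1 <| prod_le _ fun u hu v _ => by
    have := pow_five_P38_le hu
    rw [mul_P38]
    ext (i | i) <;> fin_cases i <;> simp_all

theorem card_le_finrank_of_single_mem {ι : Type*} [Finite ι] [DecidableEq ι]
    {U : Submodule F (ι → F)} {S : Finset ι} {n : ℕ} (hS : S.card = n)
    (h : ∀ p ∈ S, Pi.single p 1 ∈ U) : n ≤ finrank F U := by
  have hli := (Pi.linearIndependent_single_one ι F).comp (Subtype.val : S → ι)
    Subtype.val_injective
  simpa [hS] using card_le_finrank_of_linearIndependent hli fun p => h p p.2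

variable (s) in
theorem single_mem_pow_P38 (hr : r ≠ 0) :
    Pi.single (.inr 1) 1 ∈ (NilpPres.P38 r s).algebra.pow 2 ∧
    Pi.single (.inl 0) 1 ∈ (NilpPres.P38 r s).algebra.pow 3 ∧
    Pi.single (.inr 0) 1 ∈ (NilpPres.P38 r s).algebra.pow 3 ∧
    (∀ i, 1 ≤ i → Pi.single (.inl i) 1 ∈ (NilpPres.P38 r s).algebra.pow 4) ∧
    ∀ i, 3 ≤ i → Pi.single (.inl i) 1 ∈ (NilpPres.P38 r s).algebra.pow 5 := by
  set A := (NilpPres.P38 r s).algebra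
  have h := isTable38_single r s
  have hmul {k : ℕ} {u v w : Fin 5 ⊕ Fin 5 → F} (c : F) (hu : u ∈ A.pow (k + 1))
      (huv : c • A.mul u v = w) : w ∈ A.pow (k + 2) :=
    huv ▸ smul_mem _ _ (A.mul_mem_pow_succ hu v)
  have y₂ : Pi.single (.inr 1) 1 ∈ A.pow 2 :=
    hmul r⁻¹ mem_top (by rw [h.y₅_mul_y₄, inv_smul_smul₀ hr])
  have x₁ : Pi.single (.inl 0) 1 ∈ A.pow 3 := hmul (v := Pi.single (.inr 4) 1) 1 y₂ <| by
    rw [one_smul, mul_P38]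
    ext (i | i) <;> fin_cases i <;> simp
  have y₁ : Pi.single (.inr 0) 1 ∈ A.pow 3 := hmul (v := Pi.single (.inr 3) 1) (-1) y₂ <| by
    rw [mul_P38]
    ext (i | i) <;> fin_cases i <;> simp
  have x₂ : Pi.single (.inl 1) 1 ∈ A.pow 4 := hmul (v := Pi.single (.inr 3) 1) (-1) x₁ <| by
    rw [mul_P38]
    ext (i | i) <;> fin_cases i <;> simp
  have x₃ : Pi.single (.inl 2) 1 ∈ A.pow 4 := hmul (v := Pi.single (.inr 3) 1) (-1) y₁ <| by
    rw [mul_P38]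
    ext (i | i) <;> fin_cases i <;> simp
  have x₄ : Pi.single (.inl 3) 1 ∈ A.pow 5 := hmul (v := Pi.single (.inr 4) 1) (-r⁻¹) x₂ <| by
    rw [mul_P38]
    ext (i | i) <;> fin_cases i <;> simp [hr]
  have x₅ : Pi.single (.inl 4) 1 ∈ A.pow 5 := hmul (v := Pi.single (.inr 3) 1) r⁻¹ x₂ <| by
    rw [mul_P38]
    ext (i | i) <;> fin_cases i <;> simp [hr]
  refine ⟨y₂, x₁, y₁, fun i hi => ?_, fun i hi => ?_⟩
  · obtain rfl | rfl | rfl | rfl : i = 1 ∨ i = 2 ∨ i = 3 ∨ i = 4 := by omega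
    exacts [x₂, x₃, A.pow_succ_le 4 x₄, A.pow_succ_le 4 x₅]
  · obtain rfl | rfl : i = 3 ∨ i = 4 := by omega
    exacts [x₄, x₅]

theorem single_mem_upper_two_P38 :
    Pi.single (.inl 1) 1 ∈ (NilpPres.P38 r s).algebra.upper 2 := by
  refine (NilpPres.P38 r s).algebra.mem_upper_succ_iff.2 fun u hu => ?_
  have := pow_two_P38_le hu
  rw [mul_P38]
  ext (i | i) <;> fin_cases i <;> simp_all

theorem single_mem_upper_four_P38 :
    Pi.single (.inr 2) 1 ∈ (NilpPres.P38 r s).algebra.upper 4 := by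
  refine (NilpPres.P38 r s).algebra.mem_upper_succ_iff.2 fun u hu => ?_
  have := pow_four_P38_le hu
  rw [mul_P38]
  ext (i | i) <;> fin_cases i <;> simp_all

variable (s) in
theorem finrank_upper_pow_P38 (hr : r ≠ 0) :
    finrank F ↥((NilpPres.P38 r s).algebra.upper 1 ⊓ (NilpPres.P38 r s).algebra.pow 2) = 3 ∧
    finrank F ((NilpPres.P38 r s).algebra.upper 1) = 3 ∧
    finrank F ((NilpPres.P38 r s).algebra.pow 3) = 6 := by
  have h := isTable38_single r s
  obtain ⟨hy₂, hx₁, hy₁, hx, -⟩ := single_mem_pow_P38 s hr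
  have hx₂ := single_mem_upper_two_P38 (r := r) (s := s)
  set A := (NilpPres.P38 r s).algebra
  have hZ (i : Fin 5) (hi : 2 ≤ i) : Pi.single (.inl i) 1 ∈ A.upper 1 :=
    A.mem_upper_succ_iff.2 fun v _ => h.x_mul_eq_zero hi v
  have hx₃ (i : Fin 5) (hi : 1 ≤ i) : Pi.single (.inl i) 1 ∈ A.pow 3 :=
    A.pow_succ_le 3 (hx i hi)
  have h₁ : 3 ≤ finrank F ↥(A.upper 1 ⊓ A.pow 2) :=
    card_le_finrank_of_single_mem (ι := Fin 5 ⊕ Fin 5) (S := {.inl 2, .inl 3, .inl 4}) rfl (by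
      simp [hZ, A.pow_succ_le 2 (hx₃ _ _)])
  have h₂ : 4 ≤ finrank F (A.upper 2) :=
    card_le_finrank_of_single_mem (ι := Fin 5 ⊕ Fin 5)
      (S := {.inl 1, .inl 2, .inl 3, .inl 4}) rfl (by
      simp [A.upper_mono one_le_two (hZ _ _), hx₂])
  have h₁' : 7 ≤ finrank F (A.pow 2) :=
    card_le_finrank_of_single_mem (ι := Fin 5 ⊕ Fin 5)
      (S := {.inl 0, .inl 1, .inl 2, .inl 3, .inl 4, .inr 0, .inr 1}) rfl (by
      simp [A.pow_succ_le 2 hx₁, A.pow_succ_le 2 hy₁, hy₂, A.pow_succ_le 2 (hx₃ _ _)])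
  have h₂' : 6 ≤ finrank F (A.pow 3) :=
    card_le_finrank_of_single_mem (ι := Fin 5 ⊕ Fin 5)
      (S := {.inl 0, .inl 1, .inl 2, .inl 3, .inl 4, .inr 0}) rfl (by
      simp [hx₁, hy₁, hx₃])
  have hle := finrank_mono (inf_le_left : A.upper 1 ⊓ A.pow 2 ≤ A.upper 1)
  have hd₁ : finrank F (A.upper 1) + finrank F (A.pow 2) = _ := A.finrank_upper_add_finrank_pow 1
  have hd₂ : finrank F (A.upper 2) + finrank F (A.pow 3) = _ := A.finrank_upper_add_finrank_pow 2
  simp only [finrank_fintype_fun_eq_card, Fintype.card_sum, Fintype.card_fin] at hd₁ hd₂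
  omega

variable (s) in
theorem prod_pow_P38 (hr : r ≠ 0) :
    (NilpPres.P38 r s).algebra.prod ((NilpPres.P38 r s).algebra.pow 3)
      ((NilpPres.P38 r s).algebra.pow 2) = (NilpPres.P38 r s).algebra.pow 5 := by
  set A := (NilpPres.P38 r s).algebra with hA
  have h := isTable38_single r s
  obtain ⟨hy₂, hx₁, hy₁, -, hx⟩ := single_mem_pow_P38 s hr
  have hspan {u : Fin 5 ⊕ Fin 5 → F} {W : Submodule F (Fin 5 ⊕ Fin 5 → F)}
      (hu : u ∈ Submodule.pi {.inl 0, .inl 1, .inl 2, .inr 0, .inr 1, .inr 2, .inr 3, .inr 4}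
        fun _ => (⊥ : Submodule F F))
      (h₄ : Pi.single (.inl 3) 1 ∈ W) (h₅ : Pi.single (.inl 4) 1 ∈ W) : u ∈ W := by
    convert add_mem (smul_mem _ (u (.inl 3)) h₄) (smul_mem _ (u (.inl 4)) h₅)
    ext (i | i) <;> fin_cases i <;> simp_all
  refine le_antisymm (A.prod_le fun u hu v hv => hspan ?_ (hx 3 le_rfl) (hx 4 (by decide)))
    fun u hu => hspan (pow_five_P38_le hu) ?_ ?_
  · have := pow_three_P38_le hu
    have := pow_two_P38_le hv
    rw [hA, mul_P38]
    simp_all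
  · exact h.x₁_mul_y₂ ▸ A.mul_mem_prod hx₁ hy₂
  · exact h.y₁_mul_y₂ ▸ A.mul_mem_prod hy₁ hy₂

variable (s) in
theorem isFamily38_P38 (hr : r ≠ 0) : (NilpPres.P38 r s).algebra.IsFamily38 where
  finrank_eq := by simp
  isNilpotent := ⟨6, pow_six_P38⟩
  isIsotropic_center u hu v hv := by
    obtain ⟨h, h', -⟩ := finrank_upper_pow_P38 s hr
    have hle := inf_eq_left.1 (eq_of_le_of_finrank_eq inf_le_left (h.trans h'.symm))
    exact form_upper_pow _ hu (hle hv)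
  finrank_center := (finrank_upper_pow_P38 s hr).2.1
  finrank_pow_three := (finrank_upper_pow_P38 s hr).2.2
  prod_pow_three_pow_two := prod_pow_P38 s hr

variable (s) in
theorem isRationalForm_P38 (hr : r ≠ 0) : (NilpPres.P38 r s).algebra.IsRationalForm s
    (Pi.single (.inl 0) 1) (Pi.single (.inr 0) 1) (Pi.single (.inr 1) 1)
    (Pi.single (.inr 2) 1) := by
  have h := isTable38_single r s
  obtain ⟨hy₂, hx₁, hy₁, -⟩ := single_mem_pow_P38 s hr
  refine ⟨hx₁, hy₁, hy₂, single_mem_upper_four_P38, ?_, ?_, ?_, ?_⟩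
  · simp [h.form_xy]
  · rw [h.x₁_mul_y₂, h.y₁_mul_y₃]
  · rw [h.x₁_mul_y₃, h.y₁_mul_y₂]
  · rw [h.x₁_mul_y₂, h.y₁_mul_y₂]
    refine LinearIndependent.pair_iff.2 fun a b hab => ?_
    simpa using And.intro (congrFun hab (.inl 3)) (congrFun hab (.inl 4))

end Model

section Transport

variable {F : Type*} [Field F] {L : Type*} [AddCommGroup L] [Module F L] {A : SympAltAlg F L}
  {M : Type*} [AddCommGroup M] [Module F M] {B : SympAltAlg F M} {k : ℕ} {x : L}

namespace Iso

theorem map_mem_pow (e : Iso A B) (hx : x ∈ A.pow k) : e.toLinearEquiv x ∈ B.pow k := by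
  induction k generalizing x with
  | zero => exact mem_top
  | succ k ih =>
    cases k with
    | zero => exact mem_top
    | succ k =>
      suffices A.pow (k + 2) ≤ (B.pow (k + 2)).comap e.toLinearEquiv.toLinearMap from this hx
      refine A.prod_le fun u hu v _ => ?_
      rw [mem_comap, LinearEquiv.coe_coe, e.map_mul]
      exact B.mul_mem_pow_succ (ih hu) _

theorem map_mem_upper (e : Iso A B) (hx : x ∈ A.upper k) : e.toLinearEquiv x ∈ B.upper k := by
  induction k generalizing x with
  | zero => rw [(mem_bot F).1 hx, map_zero]; exact zero_mem _
  | succ k ih =>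
    intro v
    simpa [e.map_mul] using ih (hx (e.toLinearEquiv.symm v))

end Iso

theorem IsRationalForm.map {s : F} {x₁ y₁ y₂ y₃ : L} (h : A.IsRationalForm s x₁ y₁ y₂ y₃)
    (e : Iso A B) : B.IsRationalForm s (e.toLinearEquiv x₁) (e.toLinearEquiv y₁)
      (e.toLinearEquiv y₂) (e.toLinearEquiv y₃) where
  x₁_mem := e.map_mem_pow h.x₁_mem
  y₁_mem := e.map_mem_pow h.y₁_mem
  y₂_mem := e.map_mem_pow h.y₂_mem
  y₃_mem := e.map_mem_upper h.y₃_mem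
  form_eq_one := by rw [e.map_form, h.form_eq_one]
  y₁_mul_y₃ := by rw [← e.map_mul, h.y₁_mul_y₃, e.map_mul]
  x₁_mul_y₃ := by rw [← e.map_mul, h.x₁_mul_y₃, map_smul, e.map_mul]
  linearIndependent := by
    have hli := h.linearIndependent.map' e.toLinearEquiv.toLinearMap e.toLinearEquiv.ker
    have heq : ![B.mul (e.toLinearEquiv x₁) (e.toLinearEquiv y₂),
        B.mul (e.toLinearEquiv y₁) (e.toLinearEquiv y₂)] =
        e.toLinearEquiv.toLinearMap ∘ ![A.mul x₁ y₂, A.mul y₁ y₂] := by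
      ext i
      fin_cases i <;> simp [e.map_mul]
    exact heq ▸ hli

end Transport

section Comparison

theorem parameter_eq_of_change {F : Type*} [Field F] {s s' a b c d m n k : F}
    (h2 : (2 : F) ≠ 0) (hm : m ≠ 0) (hdet : a * d - b * c = 1)
    (e₁ : n * a + k * b = s' * (m * c)) (e₂ : n * b + k * (s * a) = s' * (m * d))
    (e₃ : n * c + k * d = m * a) (e₄ : n * d + k * (s * c) = m * b) :
    d ^ 2 - c ^ 2 * s ≠ 0 ∧ s = (d ^ 2 - c ^ 2 * s) ^ 2 * s' := by
  have hmk : m = k * (d ^ 2 - c ^ 2 * s) := by linear_combination c * e₄ - d * e₃ - m * hdet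
  have hne : k * (d ^ 2 - c ^ 2 * s) ≠ 0 := hmk ▸ hm
  have hbd : b * d = s * a * c := by
    have h0 : 2 * k * (b * d - s * a * c) = 0 := by
      linear_combination d * e₁ - c * e₂ + b * e₃ - a * e₄
    exact sub_eq_zero.1
      ((mul_eq_zero.1 h0).resolve_left (mul_ne_zero h2 (left_ne_zero_of_mul hne)))
  have hd : a * (d ^ 2 - c ^ 2 * s) = d := by linear_combination d * hdet + c * hbd
  have hc : b * (d ^ 2 - c ^ 2 * s) = s * c := by linear_combination s * c * hdet + d * hbd
  have hs' : s' * m = k * (s * a ^ 2 - b ^ 2) := by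
    linear_combination b * e₁ - a * e₂ - s' * m * hdet
  refine ⟨right_ne_zero_of_mul hne, mul_left_cancel₀ hm ?_⟩
  calc m * s = k * (s * (a * (d ^ 2 - c ^ 2 * s)) ^ 2 - (b * (d ^ 2 - c ^ 2 * s)) ^ 2) := by
        rw [hd, hc, hmk]; ring
    _ = (s' * m) * (d ^ 2 - c ^ 2 * s) ^ 2 := by rw [hs']; ring
    _ = m * ((d ^ 2 - c ^ 2 * s) ^ 2 * s') := by ring

variable {F : Type*} [Field F] {L : Type*} [AddCommGroup L] [Module F L] {A : SympAltAlg F L}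
  {s s' : F} {x₁ y₁ y₂ y₃ x₁' y₁' y₂' y₃' : L}

namespace IsRationalForm

theorem exists_smul_add_smul_add_eq_of_mem_upper_four (h : A.IsRationalForm s x₁ y₁ y₂ y₃)
    (hA : A.IsFamily38) {v : L} (hv : v ∈ A.upper 4) :
    ∃ n k : F, ∃ u ∈ A.pow 3, n • y₂ + k • y₃ + u = v := by
  rw [← hA.pow_two_sup_span_eq h.y₃_mem (h.y₃_notMem hA)] at hv
  obtain ⟨w, hw, k, rfl⟩ := exists_add_smul_eq_of_mem_sup hv
  rw [← hA.pow_three_sup_span_eq h.y₂_mem (h.y₂_notMem hA)] at hw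
  obtain ⟨u, hu, n, rfl⟩ := exists_add_smul_eq_of_mem_sup hw
  exact ⟨n, k, u, hu, by abel⟩

theorem mul_eq (h : A.IsRationalForm s x₁ y₁ y₂ y₃) (hA : A.IsFamily38) (a b n k : F) {z u : L}
    (hz : z ∈ A.upper 2) (hu : u ∈ A.pow 3) :
    A.mul (a • x₁ + b • y₁ + z) (n • y₂ + k • y₃ + u) =
      (n * a + k * b) • A.mul x₁ y₂ + (n * b + k * (s * a)) • A.mul y₁ y₂ := by
  rw [hA.add_mul_add (add_mem (smul_mem _ _ h.x₁_mem) (smul_mem _ _ h.y₁_mem)) hz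
    (add_mem (smul_mem _ _ (hA.pow_two_le_upper_four h.y₂_mem)) (smul_mem _ _ h.y₃_mem)) hu]
  simp only [map_add, map_smul, LinearMap.add_apply, LinearMap.smul_apply, h.y₁_mul_y₃,
    h.x₁_mul_y₃]
  module

theorem form_eq (h : A.IsRationalForm s x₁ y₁ y₂ y₃) (hA : A.IsFamily38) (a b c d : F) {z w : L}
    (hz : z ∈ A.upper 2) (hw : w ∈ A.upper 2) :
    A.form (a • x₁ + b • y₁ + z) (c • x₁ + d • y₁ + w) = a * d - b * c := by
  have hmem := add_mem (smul_mem _ a h.x₁_mem) (smul_mem _ b h.y₁_mem)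
  have hmem' := add_mem (add_mem (smul_mem _ c h.x₁_mem) (smul_mem _ d h.y₁_mem))
    (hA.upper_two_le_pow_three hw)
  rw [map_add A.form _ z, LinearMap.add_apply, A.form_upper_pow hz hmem', map_add _ _ w,
    A.form_skew _ w, A.form_upper_pow hw hmem]
  simp only [map_add, map_smul, LinearMap.add_apply, LinearMap.smul_apply, A.form_self,
    A.form_skew y₁ x₁, h.form_eq_one, smul_eq_mul]
  ring

theorem exists_change (h : A.IsRationalForm s x₁ y₁ y₂ y₃)
    (h' : A.IsRationalForm s' x₁' y₁' y₂' y₃') (hA : A.IsFamily38) (h2 : (2 : F) ≠ 0) :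
    ∃ a b c d m : F, a * d - b * c = 1 ∧ m ≠ 0 ∧ y₂' - m • y₂ ∈ A.pow 3 ∧
      A.mul x₁' y₂' = (m * a) • A.mul x₁ y₂ + (m * b) • A.mul y₁ y₂ ∧
      A.mul y₁' y₂' = (m * c) • A.mul x₁ y₂ + (m * d) • A.mul y₁ y₂ ∧
      d ^ 2 - c ^ 2 * s ≠ 0 ∧ s = (d ^ 2 - c ^ 2 * s) ^ 2 * s' := by
  obtain ⟨a, b, z, hz, rfl⟩ := h.exists_smul_add_smul_add_eq hA h'.x₁_mem
  obtain ⟨c, d, w, hw, rfl⟩ := h.exists_smul_add_smul_add_eq hA h'.y₁_mem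
  have hy₂' := h'.y₂_mem
  rw [← hA.pow_three_sup_span_eq h.y₂_mem (h.y₂_notMem hA)] at hy₂'
  obtain ⟨u, hu, m, rfl⟩ := exists_add_smul_eq_of_mem_sup hy₂'
  obtain ⟨n, k, v, hv, rfl⟩ := h.exists_smul_add_smul_add_eq_of_mem_upper_four hA h'.y₃_mem
  have hdet := h'.form_eq_one
  rw [h.form_eq hA _ _ _ _ hz hw] at hdet
  have hm : m ≠ 0 := by
    rintro rfl
    exact h'.y₂_notMem hA (by simpa using hu)
  have hx₂ := h.mul_eq hA a b m 0 hz hu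
  have hy₂ := h.mul_eq hA c d m 0 hw hu
  rw [zero_smul, add_zero, add_comm (m • y₂), zero_mul, add_zero, zero_mul, add_zero] at hx₂ hy₂
  have hx₃ := h'.x₁_mul_y₃
  have hy₃ := h'.y₁_mul_y₃
  rw [h.mul_eq hA _ _ _ _ hz hv, hy₂, smul_add, smul_smul, smul_smul] at hx₃
  rw [h.mul_eq hA _ _ _ _ hw hv, hx₂] at hy₃
  obtain ⟨e₁, e₂⟩ := h.linearIndependent.eq_of_pair hx₃
  obtain ⟨e₃, e₄⟩ := h.linearIndependent.eq_of_pair hy₃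
  exact ⟨a, b, c, d, m, hdet, hm, by simpa using hu, hx₂, hy₂,
    parameter_eq_of_change h2 hm hdet e₁ e₂ e₃ e₄⟩

end IsRationalForm

theorem IsTable38.parameters_eq {r r' : F} {x y x' y' : Fin 5 → L} (h : A.IsTable38 r s x y)
    (hf : A.IsRationalForm s (x 0) (y 0) (y 1) (y 2)) (h' : A.IsTable38 r' s' x' y')
    (hf' : A.IsRationalForm s' (x' 0) (y' 0) (y' 1) (y' 2)) (hA : A.IsFamily38)
    (h2 : (2 : F) ≠ 0) :
    (∃ c : F, c ≠ 0 ∧ r' = c ^ 3 * r) ∧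
      ∃ x y : F, x ^ 2 - y ^ 2 * s ≠ 0 ∧ s = (x ^ 2 - y ^ 2 * s) ^ 2 * s' := by
  obtain ⟨a, b, c, d, m, hdet, hm, hy₂, hx₄, hx₅, hs⟩ := hf.exists_change hf' hA h2
  refine ⟨⟨m⁻¹, inv_ne_zero hm, ?_⟩, d, c, hs⟩
  simp only [h.x₁_mul_y₂, h.y₁_mul_y₂, h'.x₁_mul_y₂, h'.y₁_mul_y₂] at hx₄ hx₅
  have dual (i j : Fin 5) : A.form (x' i) (y' j) = if i = j then 1 else 0 := h'.form_xy i j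
  have h₄₄ := dual 3 3
  have h₄₅ := dual 3 4
  have h₅₄ := dual 4 3
  have h₅₅ := dual 4 4
  simp only [hx₄, hx₅, map_add, map_smul, LinearMap.add_apply, LinearMap.smul_apply, smul_eq_mul,
    reduceIte, Fin.reduceEq] at h₄₄ h₄₅ h₅₄ h₅₅
  obtain ⟨D, hD⟩ : ∃ D, D = A.form (x 3) (y' 3) * A.form (x 4) (y' 4) -
    A.form (x 4) (y' 3) * A.form (x 3) (y' 4) := ⟨_, rfl⟩
  have hDm : m ^ 2 * D = 1 := by
    linear_combination m ^ 2 * hD - m ^ 2 * D * hdet + m ^ 2 * (a * d - b * c - 1) * hD +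
      (m * a * A.form (x 3) (y' 3) + m * b * A.form (x 4) (y' 3)) * h₅₅ + h₄₄ -
      (m * a * A.form (x 3) (y' 4) + m * b * A.form (x 4) (y' 4)) * h₅₄
  have hmem := hf.mul_sub_smul_mem_pow_three hA (y₄ := y 3) (y₅ := y 4)
    (by simp [h.x₁_mul_y₂, h.form_xy]) (by simp [h.y₁_mul_y₂, h.form_xy])
    (by simp [h.x₁_mul_y₂, h.form_xy]) (by simp [h.y₁_mul_y₂, h.form_xy]) (y' 3) (y' 4)
  rw [h.x₁_mul_y₂, h.y₁_mul_y₂, ← hD, A.mul_skew (y' 3), A.mul_skew (y 3), h.y₅_mul_y₄,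
    h'.y₅_mul_y₄] at hmem
  have hrm : r' * m = D * r := by
    by_contra hne
    refine hf.y₂_notMem hA ((smul_mem_iff _ (sub_ne_zero.2 hne)).1 ?_)
    convert sub_mem (neg_mem hmem) (smul_mem _ r' hy₂) using 1
    module
  field_simp
  linear_combination m ^ 2 * hrm + r * hDm

end Comparison

section Classification

variable {F : Type*} [Field F] {r s r' s' : F}

theorem describeSame_P38_iff (hr : r ≠ 0) (hr' : r' ≠ 0) (h2 : (2 : F) ≠ 0) :
    (NilpPres.P38 r' s').DescribeSame (NilpPres.P38 r s) ↔
      (∃ c : F, c ≠ 0 ∧ r' / r = c ^ 3) ∧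
        ∃ x y : F, x ^ 2 - y ^ 2 * s ≠ 0 ∧ s = (x ^ 2 - y ^ 2 * s) ^ 2 * s' := by
  have h := isTable38_single r s
  simp only [div_eq_iff hr]
  constructor
  · rintro ⟨e⟩
    exact h.parameters_eq (isRationalForm_P38 s hr) ((isTable38_single r' s').map e)
      ((isRationalForm_P38 s' hr').map e) (isFamily38_P38 s hr) h2
  · rintro ⟨⟨c, hc, rfl⟩, x, y, hD, hs⟩
    have hs' : s' = s * (x ^ 2 - y ^ 2 * s)⁻¹ ^ 2 := by
      rw [inv_pow, eq_mul_inv_iff_mul_eq₀ (pow_ne_zero 2 hD), mul_comm, ← hs]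
    rw [hs']
    exact ((h.mix (mul_inv_cancel₀ hD)).smul (mul_inv_cancel₀ hc)).describeSame

theorem div_mem_G_iff (hs : ¬ IsSquare s) (hs' : s' ≠ 0) :
    s / s' ∈ G s ↔ ∃ x y : F, x ^ 2 - y ^ 2 * s ≠ 0 ∧ s = (x ^ 2 - y ^ 2 * s) ^ 2 * s' := by
  refine exists₂_congr fun x y => and_congr (not_congr ⟨?_, fun h => ?_⟩) (div_eq_iff hs')
  · rintro ⟨⟩
    simp
  · have hy : y = 0 := by
      by_contra hy
      exact hs ⟨x / y, by field_simp; linear_combination -h⟩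
    simpa [hy] using h

end Classification

end SympAltAlg

theorem proposition4p13_general {F : Type*} [Field F] (hchar : ringChar F ≠ 2) :
    (∀ {L : Type*} [AddCommGroup L] [Module F L] (A : SympAltAlg F L),
      Module.finrank F L = 10 →
      A.IsNilpotent →
      A.IsIsotropic A.center →
      Module.finrank F A.center = 3 →
      Module.finrank F (A.pow 3) = 6 →
      A.prod (A.pow 3) (A.pow 2) = A.pow 5 →
      A.IsTypeC →
      ∃ r s : F, r ≠ 0 ∧ ¬ IsSquare s ∧ A.HasPresentation (SympAltAlg.NilpPres.P38 r s)) ∧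
    (∀ r s r' s' : F, r ≠ 0 → r' ≠ 0 →
      ((SympAltAlg.NilpPres.P38 r' s').DescribeSame (SympAltAlg.NilpPres.P38 r s) ↔
        (∃ c : F, c ≠ 0 ∧ r' / r = c ^ 3) ∧
          ∃ x y : F, x ^ 2 - y ^ 2 * s ≠ 0 ∧ s = (x ^ 2 - y ^ 2 * s) ^ 2 * s')) := by
  have h2 : (2 : F) ≠ 0 := Ring.two_ne_zero hchar
  exact ⟨fun A hL hA hZ hZ' h₃ h₅ hC =>
      SympAltAlg.IsFamily38.hasPresentation ⟨hL, hA, hZ, hZ', h₃, h₅⟩ hC h2,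
    fun _ _ _ _ hr hr' => SympAltAlg.describeSame_P38_iff hr hr' h2⟩

theorem proposition4p13 {F : Type*} [Field F] (hchar : ringChar F ≠ 2) :
    (∀ {L : Type*} [AddCommGroup L] [Module F L] (A : SympAltAlg F L),
      Module.finrank F L = 10 →
      A.IsNilpotent →
      A.IsIsotropic A.center →
      Module.finrank F A.center = 3 →
      Module.finrank F (A.pow 3) = 6 →
      A.prod (A.pow 3) (A.pow 2) = A.pow 5 →
      A.IsTypeC →
      ∃ r s : F, r ≠ 0 ∧ ¬ IsSquare s ∧ A.HasPresentation (SympAltAlg.NilpPres.P38 r s)) ∧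
    (∀ r s r' s' : F, r ≠ 0 → ¬ IsSquare s → r' ≠ 0 → ¬ IsSquare s' →
      ((SympAltAlg.NilpPres.P38 r' s').DescribeSame (SympAltAlg.NilpPres.P38 r s) ↔
        (∃ c : F, c ≠ 0 ∧ r' / r = c ^ 3) ∧ s / s' ∈ SympAltAlg.G s)) := by
  obtain ⟨hclass, hiso⟩ := proposition4p13_general hchar
  refine ⟨hclass, fun r s r' s' hr hs hr' hs' => ?_⟩
  have hs₀ : s' ≠ 0 := fun h => hs' (h ▸ IsSquare.zero)
  rw [hiso r s r' s' hr hr', SympAltAlg.div_mem_G_iff hs hs₀]
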